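/- Let $\mathcal M\subseteq\mathcal B(\mathcal H)$ be a von Neumann algebra with predual $\mathcal M_*\subseteq\mathcal M^*$ (the ultraweakly continuous functionals). Let $\mathcal M^{**}$ be its universal enveloping von Neumann algebra, that is, the double dual of $\mathcal M$ with its (Arens) product, its involution and its order, let $i:\mathcal M\to\mathcal M^{**}$ be the inclusion, and let $\mathcal M^{**}$ act on $\mathcal M^*$ by $\langle y,x\omega\rangle=\langle yx,\omega\rangle$. Let $z_0$ be the central projection of $\mathcal M^{**}$ with $z_0\mathcal M^*=\mathcal M_*$. Let $CP$ be the convex set of unital completely positive maps $\tau:\mathcal M\to\mathcal M$. Let $CP_\sigma\subseteq CP$ be the set of normal ones (those preserving least upper bounds of bounded increasing nets), and let $CP_s\subseteq CP$ be the set of singular ones (those whose normal part vanishes: $\langle\omega\tau,z_0 i(x)\rangle=0$ for all $\omega\in\mathcal M_*$ and $x\in\mathcal M$). **Proposition 2.6.** For every $\tau\in CP$ there is a unique unital normal completely positive map $\tilde\tau:\mathcal M^{**}\to\mathcal M$ with $$\langle\omega\tau,x\rangle=\langle\omega,\tilde\tau(x)\rangle\qquad(x\in\mathcal M^{**},\ \omega\in\mathcal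 M_*);$$ it is the Banach space adjoint of the map $\mathcal M_*\to\mathcal M^*$, $\omega\mapsto\omega\tau$, where $\mathcal M=(\mathcal M_*)^*$. For $\tau\in CP$: 1. For each $\lambda\in(0,1)$, there are $\tau_\sigma\in CP_\sigma$ and $\tau_s\in CP_s$ with $\tau=\lambda\tau_\sigma+(1-\lambda)\tau_s$ if and only if $\tilde\tau(z_0)=\lambda 1$. 2. $\tilde\tau(z_0)$ is a scalar multiple of $1$ if and only if $\tau$ is normal, or $\tau$ is singular, or $\tau=\lambda\tau_\sigma+(1-\lambda)\tau_s$ for some $\lambda\in(0,1)$, $\tau_\sigma\in CP_\sigma$, $\tau_s\in CP_s$. Moreover, the map $\tau\mapsto\tilde\tau$ on $CP$ is affine and one-to-one. -/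

import Mathlib

open scoped ComplexOrder InnerProductSpace

noncomputable section

/-! ### The double dual of a C⋆-algebra -/

section Bidual

variable {A : Type*} [NormedRing A] [NormedAlgebra ℂ A]

/-- The double dual `A**`. For a C⋆-algebra `A` it is a von Neumann algebra (the universal
enveloping algebra of `A`) with the product, involution and order introduced below. -/
abbrev Bidual (A : Type*) [NormedRing A] [NormedAlgebra ℂ A] : Type _ :=
  StrongDual ℂ (StrongDual ℂ A)

/-- The canonical inclusion `i : A → A**`. -/
abbrev Bidual.incl (a : A) : Bidual A := NormedSpace.inclusionInDoubleDual ℂ A a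

/-- The map `A* → (A → A*)`, `ω ↦ (a ↦ ωa)`, where `ωa` is the functional `b ↦ ω (a b)`, as a
continuous linear map. -/
def Bidual.rightAct : StrongDual ℂ A →L[ℂ] A →L[ℂ] StrongDual ℂ A :=
  (ContinuousLinearMap.compL ℂ A (A →L[ℂ] A) (StrongDual ℂ A)).flip
    (ContinuousLinearMap.mul ℂ A) ∘L ContinuousLinearMap.compL ℂ A A ℂ

theorem Bidual.rightAct_apply (ω : StrongDual ℂ A) (a b : A) :
    Bidual.rightAct ω a b = ω (a * b) := rfl

/-- The action `(x, ω) ↦ xω` of `A**` on `A*`: `⟨a, xω⟩ = ⟨x, ωa⟩` for `a ∈ A`. -/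
def Bidual.act (x : Bidual A) : StrongDual ℂ A →L[ℂ] StrongDual ℂ A :=
  ContinuousLinearMap.compL ℂ A (StrongDual ℂ A) ℂ x ∘L Bidual.rightAct

theorem Bidual.act_apply (x : Bidual A) (ω : StrongDual ℂ A) (a : A) :
    x.act ω a = x (Bidual.rightAct ω a) := rfl

/-- The (Arens) product of `A**`, the product of the universal enveloping von Neumann algebra:
`⟨x y, ω⟩ = ⟨x, yω⟩`. -/
instance Bidual.instMul : Mul (Bidual A) where
  mul x y := x ∘L Bidual.act y

theorem Bidual.mul_apply (x y : Bidual A) (ω : StrongDual ℂ A) : (x * y) ω = x (y.act ω) := rfl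

/-- The unit of `A**`. -/
instance Bidual.instOne : One (Bidual A) where
  one := Bidual.incl 1

section Star

variable [StarRing A] [NormedStarGroup A] [StarModule ℂ A]

/-- The adjoint functional `ω⋆(a) = conj (ω (a⋆))`. -/
def dualStar (ω : StrongDual ℂ A) : StrongDual ℂ A :=
  LinearMap.mkContinuous
    { toFun := fun a => star (ω (star a))
      map_add' := fun a b => by simp
      map_smul' := fun c a => by simp [star_smul] }
    ‖ω‖ (fun a => by simpa using ω.le_opNorm (star a))

theorem dualStar_apply (ω : StrongDual ℂ A) (a : A) : dualStar ω a = star (ω (star a)) := rfl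

theorem norm_dualStar_le (ω : StrongDual ℂ A) : ‖dualStar ω‖ ≤ ‖ω‖ :=
  LinearMap.mkContinuous_norm_le _ (norm_nonneg _) _

/-- The involution of `A**`: `x⋆(ω) = conj (x (ω⋆))`. -/
instance Bidual.instStar : Star (Bidual A) where
  star x := LinearMap.mkContinuous
    { toFun := fun ω => star (x (dualStar ω))
      map_add' := fun ω ρ => by
        have h : dualStar (ω + ρ) = dualStar ω + dualStar ρ := by
          ext a; simp [dualStar_apply]
        simp [h]
      map_smul' := fun c ω => by
        have h : dualStar (c • ω) = star c • dualStar ω := by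
          ext a; simp [dualStar_apply]
        simp [h] }
    ‖x‖ (fun ω => by
      have h := x.le_opNorm (dualStar ω)
      have h' := mul_le_mul_of_nonneg_left (norm_dualStar_le ω) (norm_nonneg x)
      simpa using h.trans h')

theorem Bidual.star_apply (x : Bidual A) (ω : StrongDual ℂ A) :
    (star x) ω = star (x (dualStar ω)) := rfl

end Star

/-- The order of `A**`: `x ≤ y` iff `⟨x, ω⟩ ≤ ⟨y, ω⟩` for every positive `ω ∈ A*`. (The order on
`ℂ` is that of `ComplexOrder`: `0 ≤ c` means that `c` is real and nonnegative.) -/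
instance Bidual.instPreorder [PartialOrder A] : Preorder (Bidual A) where
  le x y := ∀ ω : StrongDual ℂ A, (∀ a : A, 0 ≤ a → 0 ≤ ω a) → x ω ≤ y ω
  le_refl _ _ _ := le_rfl
  le_trans _ _ _ hxy hyz ω hω := (hxy ω hω).trans (hyz ω hω)

end Bidual

/-! ### Completely positive maps on a von Neumann algebra -/

namespace VonNeumannAlgebra

variable {H : Type*} [NormedAddCommGroup H] [InnerProductSpace ℂ H] [CompleteSpace H]
  (M : VonNeumannAlgebra H)

/-- The von Neumann algebra `M ⊆ B(H)` as a type; it carries the algebraic structure, the norm and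
the order of operators inherited from `B(H)`. -/
abbrev Elem : Type _ := M.toStarSubalgebra

/-- The predual `M_*`, as a set of functionals in `M*`: the ultraweakly continuous functionals
`x ↦ ∑ ⟨ξ_k, x η_k⟩` with `∑ ‖ξ_k‖² < ∞` and `∑ ‖η_k‖² < ∞`. -/
def predual : Set (StrongDual ℂ M.Elem) :=
  {ω | ∃ ξ η : ℕ → H, Summable (fun k => ‖ξ k‖ ^ 2) ∧ Summable (fun k => ‖η k‖ ^ 2) ∧
    ∀ x : M.Elem, HasSum (fun k => ⟪ξ k, (x : H →L[ℂ] H) (η k)⟫_ℂ) (ω x)}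

variable {M}

/-- Positivity of a matrix with entries in `M`, as an operator on `H ⊕ ⋯ ⊕ H`. -/
def IsPosMatrix {n : ℕ} (a : Matrix (Fin n) (Fin n) M.Elem) : Prop :=
  ∀ ξ : Fin n → H, 0 ≤ ∑ i, ∑ j, ⟪ξ i, (a i j : H →L[ℂ] H) (ξ j)⟫_ℂ

/-- Positivity of a matrix with entries in `M**`, under the identification of `M_n(M**)` with
`M_n(M)**`: the matrix is nonnegative on every positive functional
`a ↦ ∑ Φ_ij(a_ij)` of `M_n(M)`. -/
def IsPosBidualMatrix {n : ℕ} (x : Matrix (Fin n) (Fin n) (Bidual M.Elem)) : Prop :=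
  ∀ Φ : Matrix (Fin n) (Fin n) (StrongDual ℂ M.Elem),
    (∀ a : Matrix (Fin n) (Fin n) M.Elem, IsPosMatrix a → 0 ≤ ∑ i, ∑ j, Φ i j (a i j)) →
      0 ≤ ∑ i, ∑ j, x i j (Φ i j)

/-- Complete positivity of a map `M → M`. -/
def IsCP (τ : M.Elem →L[ℂ] M.Elem) : Prop :=
  ∀ (n : ℕ) (a : Matrix (Fin n) (Fin n) M.Elem), IsPosMatrix a → IsPosMatrix (a.map τ)

/-- Complete positivity of a map `M** → M`. -/
def IsBidualCP (T : Bidual M.Elem →L[ℂ] M.Elem) : Prop :=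
  ∀ (n : ℕ) (x : Matrix (Fin n) (Fin n) (Bidual M.Elem)),
    IsPosBidualMatrix x → IsPosMatrix (x.map T)

variable (M) in
/-- `CP`: the unital completely positive maps on `M`. (Positive maps on `M` are automatically
bounded.) -/
def CP : Set (M.Elem →L[ℂ] M.Elem) := {τ | IsCP τ ∧ τ 1 = 1}

variable (M) in
/-- `CP_σ`: the unital completely positive maps that are normal, that is, preserve least upper
bounds of bounded increasing nets. -/
def CPσ : Set (M.Elem →L[ℂ] M.Elem) := {τ | τ ∈ CP M ∧ ScottContinuous τ}

/-- `CP_s`: the unital completely positive maps that are singular. With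
`ω_σ(x) = ⟨ω, z₀ i(x)⟩` the normal part of `ω ∈ M*`, the normal part `τ_σ` of `τ` is the map with
`ω τ_σ = (ω τ)_σ` for `ω ∈ M_*`, and `τ` is singular if `τ_σ = 0`. -/
def CPs (z₀ : Bidual M.Elem) : Set (M.Elem →L[ℂ] M.Elem) :=
  {τ | τ ∈ CP M ∧ ∀ ω ∈ M.predual, ∀ x : M.Elem, (z₀ * Bidual.incl x) (ω ∘L τ) = 0}

/-- `z₀` is the central projection of `M**` with `z₀ M* = M_*`. -/
structure IsNormalProjection (z₀ : Bidual M.Elem) : Prop where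
  isStarProjection : IsStarProjection z₀
  central : ∀ x : Bidual M.Elem, z₀ * x = x * z₀
  range_act : Set.range (fun ω : StrongDual ℂ M.Elem => z₀.act ω) = M.predual

/-! ### The normal extension -/

/-- The vector functional `x ↦ ⟨ξ, x η⟩` on `M`. -/
def vectorFunctional (ξ η : H) : StrongDual ℂ M.Elem :=
  LinearMap.mkContinuous
    { toFun := fun x => ⟪ξ, (x : H →L[ℂ] H) η⟫_ℂ
      map_add' := fun x y => by simp
      map_smul' := fun c x => by simp }
    (‖ξ‖ * ‖η‖) (fun x => by
      have h1 := norm_inner_le_norm (𝕜 := ℂ) ξ ((x : H →L[ℂ] H) η)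
      have h2 := (x : H →L[ℂ] H).le_opNorm η
      have h3 : ‖x‖ = ‖(x : H →L[ℂ] H)‖ := rfl
      have h4 := mul_le_mul_of_nonneg_left h2 (norm_nonneg ξ)
      simp only [LinearMap.coe_mk, AddHom.coe_mk]
      rw [h3]
      linarith)

theorem vectorFunctional_apply (ξ η : H) (x : M.Elem) :
    vectorFunctional ξ η x = ⟪ξ, (x : H →L[ℂ] H) η⟫_ℂ := rfl

theorem norm_vectorFunctional_le (ξ η : H) :
    ‖(vectorFunctional ξ η : StrongDual ℂ M.Elem)‖ ≤ ‖ξ‖ * ‖η‖ :=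
  LinearMap.mkContinuous_norm_le _ (by positivity) _

/-- The sesquilinear form `(ξ, η) ↦ ⟨ω_{ξ,η} τ, x⟩`, where `ω_{ξ,η}` is a vector functional. -/
def extForm (τ : M.Elem →L[ℂ] M.Elem) (x : Bidual M.Elem) : H →L⋆[ℂ] H →L[ℂ] ℂ :=
  LinearMap.mkContinuous₂
    (LinearMap.mk₂'ₛₗ (starRingEnd ℂ) (RingHom.id ℂ)
      (fun ξ η : H => x (vectorFunctional ξ η ∘L τ))
      (fun ξ ξ' η => by
        rw [← map_add]; congr 1; ext a; simp [vectorFunctional_apply])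
      (fun c ξ η => by
        rw [← map_smul]; congr 1; ext a; simp [vectorFunctional_apply, mul_comm])
      (fun ξ η η' => by
        rw [← map_add]; congr 1; ext a; simp [vectorFunctional_apply])
      (fun c ξ η => by
        rw [← map_smul]; congr 1; ext a; simp [vectorFunctional_apply]))
    (‖x‖ * ‖τ‖) (fun ξ η => by
      have h1 := x.le_opNorm (vectorFunctional ξ η ∘L τ)
      have h2 := (vectorFunctional ξ η : StrongDual ℂ M.Elem).opNorm_comp_le τ
      have h3 := mul_le_mul_of_nonneg_right
        (norm_vectorFunctional_le (M := M) ξ η) (norm_nonneg τ)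
      have h4 := mul_le_mul_of_nonneg_left (h2.trans h3) (norm_nonneg x)
      simp only [LinearMap.mk₂'ₛₗ_apply]
      calc _ ≤ _ := h1
        _ ≤ _ := h4
        _ = _ := by ring)

theorem extForm_apply (τ : M.Elem →L[ℂ] M.Elem) (x : Bidual M.Elem) (ξ η : H) :
    extForm τ x ξ η = x (vectorFunctional ξ η ∘L τ) := rfl

/-- The operator on `H` with `⟨ξ, T η⟩ = ⟨ω_{ξ,η} τ, x⟩`. -/
def extOp (τ : M.Elem →L[ℂ] M.Elem) (x : Bidual M.Elem) : H →L[ℂ] H :=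
  ContinuousLinearMap.adjoint (InnerProductSpace.continuousLinearMapOfBilin (extForm τ x))

theorem inner_extOp (τ : M.Elem →L[ℂ] M.Elem) (x : Bidual M.Elem) (ξ η : H) :
    ⟪ξ, extOp τ x η⟫_ℂ = x (vectorFunctional ξ η ∘L τ) := by
  rw [extOp, ContinuousLinearMap.adjoint_inner_right,
    InnerProductSpace.continuousLinearMapOfBilin_apply, extForm_apply]

theorem extOp_mem (τ : M.Elem →L[ℂ] M.Elem) (x : Bidual M.Elem) :
    extOp τ x ∈ M.toStarSubalgebra := by
  change extOp τ x ∈ (M : Set (H →L[ℂ] H))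
  rw [← M.centralizer_centralizer]
  intro b hb
  ext η
  refine ext_inner_left ℂ fun ξ => ?_
  change ⟪ξ, b (extOp τ x η)⟫_ℂ = ⟪ξ, extOp τ x (b η)⟫_ℂ
  rw [← ContinuousLinearMap.adjoint_inner_left, inner_extOp, inner_extOp]
  congr 1
  ext a
  have h : (τ a : H →L[ℂ] H) * b = b * (τ a : H →L[ℂ] H) := hb _ (τ a).2
  have h' : (τ a : H →L[ℂ] H) (b η) = b ((τ a : H →L[ℂ] H) η) := congrArg (fun f => f η) h
  simp [vectorFunctional_apply, ContinuousLinearMap.adjoint_inner_left, h']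

theorem norm_extOp_le (τ : M.Elem →L[ℂ] M.Elem) (x : Bidual M.Elem) :
    ‖extOp τ x‖ ≤ ‖τ‖ * ‖x‖ := by
  refine ContinuousLinearMap.opNorm_le_bound _ (by positivity) fun η => ?_
  have h : ‖⟪extOp τ x η, extOp τ x η⟫_ℂ‖ ≤ ‖τ‖ * ‖x‖ * ‖extOp τ x η‖ * ‖η‖ := by
    rw [inner_extOp, ← extForm_apply]
    refine ((extForm τ x).le_opNorm₂ _ _).trans ?_
    have : ‖extForm τ x‖ ≤ ‖x‖ * ‖τ‖ := LinearMap.mkContinuous₂_norm_le _ (by positivity) _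
    rw [mul_comm ‖τ‖]
    gcongr
  rw [inner_self_eq_norm_sq_to_K] at h
  simp only [norm_pow, Complex.coe_algebraMap, Complex.norm_real, norm_norm] at h
  rcases (norm_nonneg (extOp τ x η)).eq_or_lt with h0 | h0
  · rw [← h0]; positivity
  · refine le_of_mul_le_mul_left ?_ h0
    nlinarith

/-- The extension `τ̃ : M** → M` of `τ : M → M`: the Banach space adjoint of the map
`M_* → M*`, `ω ↦ ω τ`, under the identification of `M` with the dual of `M_*`. -/
def normalExt (τ : M.Elem →L[ℂ] M.Elem) : Bidual M.Elem →L[ℂ] M.Elem :=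
  LinearMap.mkContinuous
    { toFun := fun x => ⟨extOp τ x, extOp_mem τ x⟩
      map_add' := fun x y => by
        refine Subtype.ext ?_
        ext η
        refine ext_inner_left ℂ fun ξ => ?_
        simp [inner_add_right, inner_extOp]
      map_smul' := fun c x => by
        refine Subtype.ext ?_
        ext η
        refine ext_inner_left ℂ fun ξ => ?_
        simp [inner_smul_right, inner_extOp] }
    ‖τ‖ (fun x => norm_extOp_le τ x)

/-- `T : M** → M` is a completely positive unital normal map such that
`⟨ω τ, x⟩ = ⟨ω, T x⟩` for all `x ∈ M**` and `ω ∈ M_*`. -/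
structure IsNormalExt (τ : M.Elem →L[ℂ] M.Elem) (T : Bidual M.Elem →L[ℂ] M.Elem) : Prop where
  cp : IsBidualCP T
  map_one : T 1 = 1
  normal : ScottContinuous T
  duality : ∀ ω ∈ M.predual, ∀ x : Bidual M.Elem, x (ω ∘L τ) = ω (T x)

end VonNeumannAlgebra

end

noncomputable section
open Filter Topology ComplexStarModule
set_option linter.unusedSectionVars false

universe u

namespace VonNeumannAlgebra

variable {H : Type*} [NormedAddCommGroup H] [InnerProductSpace ℂ H] [CompleteSpace H]

/-! ### The order of operators -/

/-! Everything rests on the splitting `τ = κ + (τ - κ)`, where `κ(a) = τ̃(i(a) z₀)` is the normal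
part and `κ(1) = τ̃(z₀)`. Let `τ = V⋆ π(·) V` be a Stinespring dilation, extend `π` to `M**`, and
let `p` be the image of `z₀`. This is a projection commuting with `π(M)`, so `κ = (pV)⋆ π(·) pV` and
`τ - κ = ((1-p)V)⋆ π(·) (1-p)V` are both completely positive. Since `ω κ = z₀(ω τ)` lies in `M_*`
for `ω ∈ M_*`, the map `κ` is normal.

A completely positive map vanishing at `1` is zero. Hence `τ̃(z₀) = 0` exactly when `τ` is singular,
and `τ̃(z₀) = 1` forces `τ = κ`, which is normal. If `τ̃(z₀) = λ1` with `0 < λ < 1`, the rescaled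
pieces `λ⁻¹κ` and `(1-λ)⁻¹(τ - κ)` are the required unital maps. A scalar value lies in `[0,1]`
because `0 ≤ κ(1) ≤ 1`.

The substantial point is that order continuity of `τ` implies `τ̃(z₀) = 1`
(`normalExt_eq_one_of_scottContinuous`). The functional `ψ = ω_ξ (τ - κ)` is positive and order
continuous, and comes from a vector killed by `p`. Since `z₀` acts as `0` on that vector and as the
identity on `H`, Hahn-Banach gives self-adjoint `b ∈ M` imitating it at both places
(`exists_approx`). Bounded transforms `1 - (1+a)⁻¹` of multiples of `b²`, with monotone limits, turn
this approximate separation into an exact one and give `ψ(1) = 0`.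

Normality of `τ̃` itself comes from monotone convergence in `M**`, tested on positive functionals;
these span `M*` by a Jordan decomposition. -/

theorem opNonneg_iff {a : H →L[ℂ] H} : 0 ≤ a ↔ ∀ ξ, 0 ≤ ⟪ξ, a ξ⟫_ℂ := by
  rw [ContinuousLinearMap.nonneg_iff_isPositive, ContinuousLinearMap.isPositive_iff_complex]
  refine forall_congr' fun ξ => ?_
  rw [← inner_conj_symm ξ (a ξ), ← Complex.star_def, star_nonneg_iff, Complex.nonneg_iff,
    Complex.ext_iff]
  simp [and_comm]

theorem opLe_iff {a b : H →L[ℂ] H} : a ≤ b ↔ ∀ ξ, ⟪ξ, a ξ⟫_ℂ ≤ ⟪ξ, b ξ⟫_ℂ := by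
  rw [← sub_nonneg, opNonneg_iff]
  simp [sub_nonneg]

/-! ### Positive functionals on `M` and the Jordan decomposition -/

variable {M : VonNeumannAlgebra H}

theorem nonneg_iff {a : M.Elem} : 0 ≤ a ↔ ∀ ξ, 0 ≤ ⟪ξ, (a : H →L[ℂ] H) ξ⟫_ℂ :=
  opNonneg_iff (a := (a : H →L[ℂ] H))

theorem le_iff {a b : M.Elem} :
    a ≤ b ↔ ∀ ξ, ⟪ξ, (a : H →L[ℂ] H) ξ⟫_ℂ ≤ ⟪ξ, (b : H →L[ℂ] H) ξ⟫_ℂ :=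
  opLe_iff (a := (a : H →L[ℂ] H)) (b := (b : H →L[ℂ] H))

/-- Positivity of a functional on `M`. -/
def IsPosFunctional (ω : StrongDual ℂ M.Elem) : Prop := ∀ a : M.Elem, 0 ≤ a → 0 ≤ ω a

theorem abs_re_inner_le (b : M.Elem) (ξ : H) :
    |(⟪ξ, (b : H →L[ℂ] H) ξ⟫_ℂ).re| ≤ ‖(b : H →L[ℂ] H)‖ * ‖ξ‖ ^ 2 := by
  refine (Complex.abs_re_le_norm _).trans ((norm_inner_le_norm _ _).trans ?_)
  have h := (b : H →L[ℂ] H).le_opNorm ξ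
  nlinarith [norm_nonneg ξ]

theorem inner_one_re (ξ : H) : (⟪ξ, ξ⟫_ℂ).re = ‖ξ‖ ^ 2 := by
  rw [inner_self_eq_norm_sq_to_K]; norm_cast

theorem inner_im_eq_zero {a : H →L[ℂ] H} (ha : IsSelfAdjoint a) (ξ : H) :
    (⟪ξ, a ξ⟫_ℂ).im = 0 := by
  rw [← Complex.conj_eq_iff_im, inner_conj_symm, ← ContinuousLinearMap.adjoint_inner_right,
    ← ContinuousLinearMap.star_eq_adjoint, ha.star_eq]

/-- A real functional that is nonnegative on accretive operators is the real part of a positive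
functional. -/
theorem exists_posFunctional_re_eq (g : M.Elem →ₗ[ℝ] ℝ)
    (hg : ∀ b : M.Elem, (∀ ξ, 0 ≤ (⟪ξ, (b : H →L[ℂ] H) ξ⟫_ℂ).re) → 0 ≤ g b) :
    ∃ ω : StrongDual ℂ M.Elem, IsPosFunctional ω ∧ ∀ b, (ω b).re = g b := by
  have bound : ∀ b : M.Elem, |g b| ≤ g 1 * ‖b‖ := by
    intro b
    have h1 : 0 ≤ g (b + (‖b‖ : ℝ) • (1 : M.Elem)) := hg _ fun ξ => by
      have := neg_abs_le (⟪ξ, (b : H →L[ℂ] H) ξ⟫_ℂ).re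
      have h2 := abs_re_inner_le b ξ
      simp [inner_smul_right_eq_smul, inner_one_re, -inner_self_eq_norm_sq_to_K]
      linarith
    have h2 : 0 ≤ g (-b + (‖b‖ : ℝ) • (1 : M.Elem)) := hg _ fun ξ => by
      have := le_abs_self (⟪ξ, (b : H →L[ℂ] H) ξ⟫_ℂ).re
      have h2 := abs_re_inner_le b ξ
      simp [inner_smul_right_eq_smul, inner_one_re, -inner_self_eq_norm_sq_to_K]
      linarith
    rw [map_add, map_smul, smul_eq_mul] at h1 h2
    rw [map_neg] at h2
    rw [abs_le]; constructor <;> linarith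
  let G : StrongDual ℝ M.Elem := g.mkContinuous (g 1) bound
  refine ⟨G.extendRCLike, fun a ha => ?_, fun b => ?_⟩
  -- For positive `a`, both `ia` and `-ia` are accretive, so the imaginary part of the complexified
  -- functional vanishes at `a`.
  · have h0 : g (Complex.I • a) = 0 := by
      have hz : ∀ ξ, (⟪ξ, (a : H →L[ℂ] H) ξ⟫_ℂ).im = 0 := fun ξ =>
        (Complex.nonneg_iff.1 (nonneg_iff.1 ha ξ)).2.symm
      apply le_antisymm
      · rw [← neg_nonneg, ← map_neg]
        exact hg _ fun ξ => by simp [inner_smul_right, hz]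
      · exact hg _ fun ξ => by simp [hz]
    have h1 : 0 ≤ g a := hg a fun ξ => (Complex.nonneg_iff.1 (nonneg_iff.1 ha ξ)).1
    simp [StrongDual.extendRCLike_apply, G, h0, h1]
  · simp [StrongDual.extendRCLike_apply, G]

/-- The shift `a + t` lies between `0` and `2t`, and the triangle inequality then gives the crude
constant `3`. On the zero space `t` may be negative, hence the alternative. -/
theorem norm_le_of_abs_inner_le {a : M.Elem} (ha' : IsSelfAdjoint (a : H →L[ℂ] H)) {t : ℝ}
    (h1 : ∀ ξ, 0 ≤ (⟪ξ, (a : H →L[ℂ] H) ξ⟫_ℂ).re + t * ‖ξ‖ ^ 2)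
    (h2 : ∀ ξ, 0 ≤ -(⟪ξ, (a : H →L[ℂ] H) ξ⟫_ℂ).re + t * ‖ξ‖ ^ 2) : ‖a‖ ≤ 3 * t ∨ Subsingleton H := by
  rcases subsingleton_or_nontrivial H with hH | hH
  · exact .inr hH
  left
  have ht : 0 ≤ t := by
    obtain ⟨ξ, hξ⟩ := exists_ne (0 : H)
    have : 0 < ‖ξ‖ ^ 2 := by positivity
    nlinarith [h1 ξ, h2 ξ]
  set b : H →L[ℂ] H := a + (t : ℂ) • 1 with hb
  have hinner : ∀ ξ, ⟪ξ, b ξ⟫_ℂ = (((⟪ξ, (a : H →L[ℂ] H) ξ⟫_ℂ).re + t * ‖ξ‖ ^ 2 : ℝ) : ℂ) := by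
    intro ξ
    apply Complex.ext
    · simp [hb, inner_one_re, -inner_self_eq_norm_sq_to_K]
      left; norm_cast
    · rw [hb]
      simp only [add_apply, smul_apply,
        one_apply_eq_self, inner_add_right, inner_smul_right, Complex.add_im,
        inner_im_eq_zero ha' ξ, Complex.im_ofReal_mul, Complex.ofReal_im]
      have : (⟪ξ, ξ⟫_ℂ).im = 0 := inner_self_im (𝕜 := ℂ) ξ
      rw [this]; simp
  have hb0 : 0 ≤ b := opNonneg_iff.2 fun ξ => by
    rw [hinner]; exact_mod_cast h1 ξ
  have hb1 : b ≤ algebraMap ℝ _ (2 * t) := opLe_iff.2 fun ξ => by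
    rw [hinner, Algebra.algebraMap_eq_smul_one]
    simp only [smul_apply, one_apply_eq_self]
    rw [inner_smul_right_eq_smul, inner_self_eq_norm_sq_to_K]
    simp only [Complex.real_smul, Complex.coe_algebraMap]
    have := h2 ξ
    norm_cast
    linarith
  have hn := (CStarAlgebra.norm_le_iff_le_algebraMap b (by positivity) hb0).2 hb1
  have : ‖(a : H →L[ℂ] H)‖ ≤ ‖b‖ + ‖(t : ℂ) • (1 : H →L[ℂ] H)‖ := by
    rw [show (a : H →L[ℂ] H) = b - (t : ℂ) • 1 by simp [hb]]
    exact norm_sub_le _ _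
  have h3 : ‖(t : ℂ) • (1 : H →L[ℂ] H)‖ = t := by
    rw [norm_smul, norm_one]; simp [abs_of_nonneg ht]
  change ‖(a : H →L[ℂ] H)‖ ≤ _
  linarith

/-- An abstract Jordan decomposition: a functional on a space with order unit that is dominated by
the order unit on a subspace is there a difference of positive functionals. -/
theorem exists_eq_sub_of_pointedCone {V : Type*} [AddCommGroup V] [Module ℝ V]
    (P : PointedCone ℝ V) (e : V) (he : e ∈ P) (hP : ∀ b, ∃ t : ℝ, b + t • e ∈ P)
    (S : Submodule ℝ V) (F : V →ₗ[ℝ] ℝ) (C : ℝ)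
    (hF : ∀ a ∈ S, ∀ t : ℝ, a + t • e ∈ P → -a + t • e ∈ P → 0 ≤ F a + C * t) :
    ∃ g₁ g₂ : V →ₗ[ℝ] ℝ, (∀ b ∈ P, 0 ≤ g₁ b) ∧ (∀ b ∈ P, 0 ≤ g₂ b) ∧
      ∀ a ∈ S, F a = g₁ a - g₂ a := by
  let L₁ : (V × V × ℝ) →ₗ[ℝ] V := LinearMap.fst ℝ V (V × ℝ) +
    (LinearMap.snd ℝ V ℝ ∘ₗ LinearMap.snd ℝ V (V × ℝ)).smulRight e
  let L₂ : (V × V × ℝ) →ₗ[ℝ] V := LinearMap.fst ℝ V ℝ ∘ₗ LinearMap.snd ℝ V (V × ℝ) +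
    (LinearMap.snd ℝ V ℝ ∘ₗ LinearMap.snd ℝ V (V × ℝ)).smulRight e
  -- A single Riesz extension on `V × V × ℝ` produces both positive parts: extend `F(a) + C t` from
  -- the triples `(a, -a, t)` and restrict the result to the two copies of `V`.
  let Q : PointedCone ℝ (V × V × ℝ) := P.comap L₁ ⊓ P.comap L₂
  have hQ : ∀ b c t, ((b, c, t) : V × V × ℝ) ∈ Q ↔ b + t • e ∈ P ∧ c + t • e ∈ P :=
    fun b c t => Iff.rfl
  let Fb : (V × V × ℝ) →ₗ[ℝ] ℝ := F ∘ₗ LinearMap.fst ℝ V (V × ℝ) +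
    C • (LinearMap.snd ℝ V ℝ ∘ₗ LinearMap.snd ℝ V (V × ℝ))
  have hFb : ∀ b c t, Fb (b, c, t) = F b + C * t := fun b c t => rfl
  let D : Submodule ℝ (V × V × ℝ) := S.comap (LinearMap.fst ℝ V (V × ℝ)) ⊓
    LinearMap.ker (LinearMap.fst ℝ V (V × ℝ) + LinearMap.fst ℝ V ℝ ∘ₗ LinearMap.snd ℝ V (V × ℝ))
  have hD : ∀ b c t, ((b, c, t) : V × V × ℝ) ∈ D ↔ b ∈ S ∧ b + c = 0 := fun b c t => Iff.rfl
  obtain ⟨g, hg1, hg2⟩ := riesz_extension Q (Fb.toPMap D)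
    (by
      rintro ⟨⟨a, a', t⟩, hd⟩ hx
      obtain ⟨ha, h⟩ := (hD _ _ _).1 hd
      obtain rfl : a' = -a := (neg_eq_of_add_eq_zero_right h).symm
      have := (hQ _ _ _).1 hx
      simpa [hFb] using hF a ha t this.1 this.2)
    (by
      rintro ⟨b, c, t⟩
      obtain ⟨u, hu⟩ := hP b
      obtain ⟨v, hv⟩ := hP c
      refine ⟨⟨(0, 0, max u v - t), (hD _ _ _).2 ⟨S.zero_mem, add_zero _⟩⟩, ?_⟩
      have h1 : b + max u v • e = (b + u • e) + (max u v - u) • e := by module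
      have h2 : c + max u v • e = (c + v • e) + (max u v - v) • e := by module
      have key : ((0, 0, max u v - t) + (b, c, t) : V × V × ℝ) = (b, c, max u v) := by simp
      change ((0, 0, max u v - t) + (b, c, t) : V × V × ℝ) ∈ Q
      rw [key, hQ, h1, h2]
      exact ⟨P.add_mem hu (P.smul_mem (sub_nonneg.2 (le_max_left u v)) he),
        P.add_mem hv (P.smul_mem (sub_nonneg.2 (le_max_right u v)) he)⟩)
  refine ⟨g ∘ₗ LinearMap.inl ℝ V (V × ℝ), g ∘ₗ LinearMap.inr ℝ V (V × ℝ) ∘ₗ LinearMap.inl ℝ V ℝ,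
    fun b hb => hg2 (b, 0, 0) ((hQ _ _ _).2 ?_), fun b hb => hg2 (0, b, 0) ((hQ _ _ _).2 ?_),
    fun a ha => ?_⟩
  · simpa using hb
  · simpa using hb
  · have h := hg1 ⟨(a, -a, 0), (hD _ _ _).2 ⟨ha, add_neg_cancel a⟩⟩
    have h' : ((a, -a, 0) : V × V × ℝ) = (a, 0, 0) - (0, a, 0) := by simp
    have h2 : F a = g (a, -a, 0) := by rw [h]; simp [hFb]
    rw [h2, h', map_sub]
    rfl

/-- The cone of accretive elements of `M`. -/
def accretiveCone (M : VonNeumannAlgebra H) : PointedCone ℝ M.Elem where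
  carrier := {a | ∀ ξ : H, 0 ≤ (⟪ξ, (a : H →L[ℂ] H) ξ⟫_ℂ).re}
  add_mem' {x y} hx hy ξ := by
    simpa [inner_add_right] using add_nonneg (hx ξ) (hy ξ)
  zero_mem' ξ := by simp
  smul_mem' := by
    rintro ⟨c, hc⟩ x hx ξ
    simpa [inner_smul_right_eq_smul, Nonneg.mk_smul] using mul_nonneg hc (hx ξ)

theorem mem_accretiveCone {a : M.Elem} :
    a ∈ accretiveCone M ↔ ∀ ξ : H, 0 ≤ (⟪ξ, (a : H →L[ℂ] H) ξ⟫_ℂ).re := Iff.rfl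

theorem re_inner_add_smul_one (a : M.Elem) (t : ℝ) (ξ : H) :
    (⟪ξ, ((a + t • (1 : M.Elem) : M.Elem) : H →L[ℂ] H) ξ⟫_ℂ).re =
      (⟪ξ, (a : H →L[ℂ] H) ξ⟫_ℂ).re + t * ‖ξ‖ ^ 2 := by
  simp [inner_smul_right_eq_smul, inner_one_re, -inner_self_eq_norm_sq_to_K]

/-- The abstract decomposition needs `1` to be an order unit for all of `M`, not only its
self-adjoint part; this is why the accretive cone replaces the positive one. -/
theorem exists_jordan_re (F : M.Elem →ₗ[ℝ] ℝ) (C : ℝ) (hF : ∀ a, |F a| ≤ C * ‖a‖) :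
    ∃ ω₁ ω₂ : StrongDual ℂ M.Elem, IsPosFunctional ω₁ ∧ IsPosFunctional ω₂ ∧
      ∀ a : M.Elem, IsSelfAdjoint a → F a = (ω₁ a).re - (ω₂ a).re := by
  rcases subsingleton_or_nontrivial H with hH | hH
  · refine ⟨0, 0, by simp [IsPosFunctional], by simp [IsPosFunctional], fun a _ => ?_⟩
    have : a = 0 := by ext ξ; exact Subsingleton.elim _ _
    simp [this]
  have hC : 0 ≤ C := by
    have := (abs_nonneg _).trans (hF 1)
    have h1 : ‖(1 : M.Elem)‖ = 1 := norm_one (α := H →L[ℂ] H)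
    rwa [h1, mul_one] at this
  obtain ⟨g₁, g₂, p₁, p₂, e⟩ := exists_eq_sub_of_pointedCone (accretiveCone M) 1
    (mem_accretiveCone.2 fun ξ => by
      simp [inner_one_re, -inner_self_eq_norm_sq_to_K])
    (fun b => ⟨‖b‖, mem_accretiveCone.2 fun ξ => by
      have h1 : -(‖b‖ * ‖ξ‖ ^ 2) ≤ _ := (abs_le.1 (abs_re_inner_le b ξ)).1
      rw [re_inner_add_smul_one]
      linarith⟩)
    (selfAdjoint.submodule ℝ M.Elem) F (3 * C) (fun a ha t h1 h2 => by
      rw [mem_accretiveCone] at h1 h2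
      simp only [re_inner_add_smul_one] at h1 h2
      have h := norm_le_of_abs_inner_le (congrArg Subtype.val ha) h1 (fun ξ => by simpa using h2 ξ)
      rcases h with h | h
      · have h1 := (abs_le.1 (hF a)).1
        have h2 := mul_le_mul_of_nonneg_left h hC
        linarith
      · exact (not_subsingleton H h).elim)
  obtain ⟨ω₁, q₁, e₁⟩ := exists_posFunctional_re_eq g₁ fun b hb => p₁ b (mem_accretiveCone.2 hb)
  obtain ⟨ω₂, q₂, e₂⟩ := exists_posFunctional_re_eq g₂ fun b hb => p₂ b (mem_accretiveCone.2 hb)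
  exact ⟨ω₁, ω₂, q₁, q₂, fun a ha => by rw [e a ha, e₁, e₂]⟩

theorem IsPosFunctional.im_eq_zero {ω : StrongDual ℂ M.Elem} (hω : IsPosFunctional ω)
    {a : M.Elem} (ha : IsSelfAdjoint a) : (ω a).im = 0 := by
  have h1 : 0 ≤ ω (a + (‖a‖ : ℂ) • (1 : M.Elem)) := hω _ <| by
    have ha' : IsSelfAdjoint (a : H →L[ℂ] H) := congrArg Subtype.val ha
    have := ha'.neg_algebraMap_norm_le_self
    rw [neg_le_iff_add_nonneg] at this
    exact this
  have h2 : 0 ≤ ω 1 := hω _ (zero_le_one (α := H →L[ℂ] H))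
  have h1' := (Complex.nonneg_iff.1 h1).2
  have h2' := (Complex.nonneg_iff.1 h2).2
  simpa [← h2'] using h1'.symm

/-- Every functional is a linear combination of four positive functionals. -/
theorem exists_jordan (f : StrongDual ℂ M.Elem) :
    ∃ ω₁ ω₂ ω₃ ω₄ : StrongDual ℂ M.Elem, IsPosFunctional ω₁ ∧ IsPosFunctional ω₂ ∧
      IsPosFunctional ω₃ ∧ IsPosFunctional ω₄ ∧
      f = (ω₁ - ω₂) + Complex.I • (ω₃ - ω₄) := by
  obtain ⟨ω₁, ω₂, p₁, p₂, e⟩ := exists_jordan_re (M := M)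
    (Complex.reLm ∘ₗ (f : M.Elem →ₗ[ℂ] ℂ).restrictScalars ℝ) ‖f‖
    fun a => (Complex.abs_re_le_norm _).trans (f.le_opNorm a)
  obtain ⟨ω₃, ω₄, p₃, p₄, e'⟩ := exists_jordan_re (M := M)
    (Complex.imLm ∘ₗ (f : M.Elem →ₗ[ℂ] ℂ).restrictScalars ℝ) ‖f‖
    fun a => (Complex.abs_im_le_norm _).trans (f.le_opNorm a)
  refine ⟨ω₁, ω₂, ω₃, ω₄, p₁, p₂, p₃, p₄, ?_⟩
  have key : ∀ a : M.Elem, IsSelfAdjoint a →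
      f a = ((ω₁ - ω₂) + Complex.I • (ω₃ - ω₄)) a := by
    intro a ha
    have h1 := e a ha
    have h2 := e' a ha
    apply Complex.ext
    · simpa [p₃.im_eq_zero ha, p₄.im_eq_zero ha] using h1
    · simpa [p₁.im_eq_zero ha, p₂.im_eq_zero ha] using h2
  ext a
  conv_lhs => rw [← realPart_add_I_smul_imaginaryPart a]
  conv_rhs => rw [← realPart_add_I_smul_imaginaryPart a]
  rw [map_add, map_add, map_smul, map_smul, key _ (ℜ a).2, key _ (ℑ a).2]

/-! ### Monotone convergence in the double dual -/

/-- A directed subset of `M**` that is bounded above converges pointwise on `M*`. -/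
theorem exists_tendsto_of_directedOn {D : Set (Bidual M.Elem)} (hne : D.Nonempty)
    (hD : DirectedOn (· ≤ ·) D) {x : Bidual M.Elem} (hx : x ∈ upperBounds D) :
    ∃ Y : Bidual M.Elem, ∀ ω, Tendsto (fun d : D => (d : Bidual M.Elem) ω) atTop (𝓝 (Y ω)) := by
  have : Nonempty D := hne.to_subtype
  have : IsDirectedOrder D := directedOn_iff_isDirectedOrder.1 hD
  obtain ⟨d₀⟩ : Nonempty D := hne.to_subtype
  have key : ∀ ω : StrongDual ℂ M.Elem, IsPosFunctional ω →
      (∃ l, Tendsto (fun d : D => (d : Bidual M.Elem) ω) atTop (𝓝 l)) ∧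
      -- `D` is bounded only above, so uniform bounds are available only on the tail beyond `d₀`.
      ∃ C, ∀ d : Set.Ici d₀, ‖(d.1 : Bidual M.Elem) ω‖ ≤ C := by
    intro ω hω
    have hmono : ∀ d d' : D, d ≤ d' → (d : Bidual M.Elem) ω ≤ (d' : Bidual M.Elem) ω :=
      fun d d' h => h ω hω
    have hub : ∀ d : D, (d : Bidual M.Elem) ω ≤ x ω := fun d => hx d.2 ω hω
    -- Comparable complex numbers have equal imaginary parts, so only the real parts move.
    have him : ∀ d : D, ((d : Bidual M.Elem) ω).im = (x ω).im := fun d =>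
      (Complex.le_def.1 (hub d)).2
    constructor
    · have hm : Monotone fun d : D => ((d : Bidual M.Elem) ω).re := fun d d' h =>
        (Complex.le_def.1 (hmono d d' h)).1
      have ht := tendsto_atTop_ciSup hm
        ⟨(x ω).re, by rintro _ ⟨d, rfl⟩; exact (Complex.le_def.1 (hub d)).1⟩
      refine ⟨((⨆ d : D, ((d : Bidual M.Elem) ω).re : ℝ) : ℂ) + (x ω).im * Complex.I, ?_⟩
      have h2 : (fun d : D => (d : Bidual M.Elem) ω) =
          fun d : D => ((((d : Bidual M.Elem) ω).re : ℝ) : ℂ) + (x ω).im * Complex.I := by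
        ext d
        rw [← him d, Complex.re_add_im]
      rw [h2]
      exact ((Complex.continuous_ofReal.tendsto _).comp ht).add_const _
    · refine ⟨|((d₀ : Bidual M.Elem) ω).re| + |(x ω).re| + |(x ω).im|, fun d => ?_⟩
      refine (Complex.norm_le_abs_re_add_abs_im _).trans ?_
      rw [him]
      have h1 := (Complex.le_def.1 (hmono d₀ d.1 d.2)).1
      have h2 := (Complex.le_def.1 (hub d.1)).1
      gcongr
      rw [abs_le]
      constructor
      · have := neg_abs_le ((d₀ : Bidual M.Elem) ω).re
        have := abs_nonneg (x ω).re
        linarith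
      · have := le_abs_self (x ω).re
        have := abs_nonneg ((d₀ : Bidual M.Elem) ω).re
        linarith
  have all : ∀ ω : StrongDual ℂ M.Elem,
      (∃ l, Tendsto (fun d : D => (d : Bidual M.Elem) ω) atTop (𝓝 l)) ∧
      ∃ C, ∀ d : Set.Ici d₀, ‖(d.1 : Bidual M.Elem) ω‖ ≤ C := by
    intro ω
    obtain ⟨ω₁, ω₂, ω₃, ω₄, p₁, p₂, p₃, p₄, rfl⟩ := exists_jordan ω
    obtain ⟨⟨l₁, t₁⟩, C₁, b₁⟩ := key _ p₁
    obtain ⟨⟨l₂, t₂⟩, C₂, b₂⟩ := key _ p₂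
    obtain ⟨⟨l₃, t₃⟩, C₃, b₃⟩ := key _ p₃
    obtain ⟨⟨l₄, t₄⟩, C₄, b₄⟩ := key _ p₄
    refine ⟨⟨(l₁ - l₂) + Complex.I • (l₃ - l₄), ?_⟩, (C₁ + C₂) + (C₃ + C₄), fun d => ?_⟩
    · simp only [map_add, map_sub, map_smul]
      exact (t₁.sub t₂).add ((t₃.sub t₄).const_smul _)
    · simp only [map_add, map_sub, map_smul]
      refine (norm_add_le _ _).trans (add_le_add ?_ ?_)
      · exact (norm_sub_le _ _).trans (add_le_add (b₁ d) (b₂ d))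
      · rw [norm_smul, Complex.norm_I, one_mul]
        exact (norm_sub_le _ _).trans (add_le_add (b₃ d) (b₄ d))
  obtain ⟨C, hC⟩ := banach_steinhaus (g := fun d : Set.Ici d₀ => (d.1 : Bidual M.Elem))
    fun ω => (all ω).2
  choose Y hY using fun ω => (all ω).1
  refine ⟨LinearMap.mkContinuous
    { toFun := Y
      map_add' := fun ω ρ => tendsto_nhds_unique (hY (ω + ρ)) (by
        simpa only [map_add] using (hY ω).add (hY ρ))
      map_smul' := fun c ω => tendsto_nhds_unique (hY (c • ω)) (by
        simpa only [map_smul, RingHom.id_apply] using (hY ω).const_smul c) } C fun ω => ?_, hY⟩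
  refine le_of_tendsto (hY ω).norm ?_
  filter_upwards [eventually_ge_atTop d₀] with d hd
  exact (ContinuousLinearMap.le_opNorm _ _).trans (by gcongr; exact hC ⟨d, hd⟩)

theorem le_of_tendsto_of_directedOn {D : Set (Bidual M.Elem)}
    (hD : DirectedOn (· ≤ ·) D) {Y : Bidual M.Elem}
    (hY : ∀ ω, Tendsto (fun d : D => (d : Bidual M.Elem) ω) atTop (𝓝 (Y ω))) {d : Bidual M.Elem}
    (hd : d ∈ D) : d ≤ Y := by
  have : Nonempty D := ⟨⟨d, hd⟩⟩
  have : IsDirectedOrder D := directedOn_iff_isDirectedOrder.1 hD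
  intro ω hω
  refine ge_of_tendsto (hY ω) ?_
  filter_upwards [eventually_ge_atTop (⟨d, hd⟩ : D)] with d' hd'
  exact hd' ω hω

end VonNeumannAlgebra

/-! ### Identities for the Arens product and the action on `A*` -/

namespace Bidual

variable {A : Type*} [NormedRing A] [NormedAlgebra ℂ A]

theorem act_mul_apply (x y : Bidual A) (ω : StrongDual ℂ A) :
    (x * y).act ω = x.act (y.act ω) := by
  ext a
  rw [act_apply, act_apply, mul_apply]
  congr 1
  ext b
  rw [act_apply, rightAct_apply, act_apply]
  congr 1
  ext c
  simp only [rightAct_apply, mul_assoc]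

theorem act_incl_apply (a : A) (ω : StrongDual ℂ A) (b : A) : (incl a).act ω b = ω (b * a) := rfl

theorem mul_incl_one (x : Bidual A) : x * incl 1 = x := by
  ext ω
  rw [mul_apply]
  congr 1
  ext a
  rw [act_incl_apply, mul_one]

theorem incl_mul_apply (a : A) (x : Bidual A) (ω : StrongDual ℂ A) :
    (incl a * x) ω = x.act ω a := rfl

theorem act_one (x : Bidual A) (ω : StrongDual ℂ A) : x.act ω 1 = x ω := by
  rw [act_apply]
  congr 1
  ext a
  rw [rightAct_apply, one_mul]

end Bidual

/-! ### The predual and ultraweak monotone convergence -/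

namespace VonNeumannAlgebra

variable {H : Type*} [NormedAddCommGroup H] [InnerProductSpace ℂ H] [CompleteSpace H]
  {M : VonNeumannAlgebra H}

theorem vectorFunctional_mem_predual (ξ η : H) :
    (vectorFunctional ξ η : StrongDual ℂ M.Elem) ∈ M.predual := by
  have hs : ∀ ζ : H, Summable fun k : ℕ => ‖(Pi.single 0 ζ : ℕ → H) k‖ ^ 2 := fun ζ =>
    summable_of_ne_finset_zero (s := {0}) fun k hk => by
      rw [Pi.single_eq_of_ne (by simpa using hk)]; simp
  refine ⟨Pi.single 0 ξ, Pi.single 0 η, hs ξ, hs η, fun x => ?_⟩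
  have h := hasSum_single (f := fun k : ℕ => ⟪(Pi.single 0 ξ : ℕ → H) k,
    (x : H →L[ℂ] H) ((Pi.single 0 η : ℕ → H) k)⟫_ℂ) 0 (fun k hk => by
      rw [Pi.single_eq_of_ne hk]; simp)
  simpa [vectorFunctional_apply] using h

/-- A functional in the predual is the norm convergent sum of its vector functionals. -/
theorem hasSum_vectorFunctional {ω : StrongDual ℂ M.Elem} {ξ η : ℕ → H}
    (hξ : Summable fun k => ‖ξ k‖ ^ 2) (hη : Summable fun k => ‖η k‖ ^ 2)
    (h : ∀ x : M.Elem, HasSum (fun k => ⟪ξ k, (x : H →L[ℂ] H) (η k)⟫_ℂ) (ω x)) :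
    HasSum (fun k => (vectorFunctional (ξ k) (η k) : StrongDual ℂ M.Elem)) ω := by
  have hs : Summable fun k => (vectorFunctional (ξ k) (η k) : StrongDual ℂ M.Elem) := by
    refine Summable.of_norm_bounded (hξ.add hη) fun k => ?_
    refine (norm_vectorFunctional_le _ _).trans ?_
    nlinarith [sq_nonneg (‖ξ k‖ - ‖η k‖), sq_nonneg ‖ξ k‖, sq_nonneg ‖η k‖]
  obtain ⟨ρ, hρ⟩ := hs
  convert hρ
  ext x
  exact (h x).unique (hρ.mapL (ContinuousLinearMap.apply ℂ ℂ x))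

theorem inner_normalExt (τ : M.Elem →L[ℂ] M.Elem) (x : Bidual M.Elem) (ξ η : H) :
    ⟪ξ, (normalExt τ x : H →L[ℂ] H) η⟫_ℂ = x (vectorFunctional ξ η ∘L τ) :=
  inner_extOp τ x ξ η

theorem elem_ext {a b : M.Elem}
    (h : ∀ ξ η, ⟪ξ, (a : H →L[ℂ] H) η⟫_ℂ = ⟪ξ, (b : H →L[ℂ] H) η⟫_ℂ) : a = b := by
  refine Subtype.ext (ContinuousLinearMap.ext fun η => ext_inner_left ℂ fun ξ => h ξ η)

theorem normalExt_incl (τ : M.Elem →L[ℂ] M.Elem) (a : M.Elem) :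
    normalExt τ (Bidual.incl a) = τ a :=
  elem_ext fun ξ η => inner_normalExt τ _ ξ η

theorem normalExt_add (τ₁ τ₂ : M.Elem →L[ℂ] M.Elem) :
    normalExt (τ₁ + τ₂) = normalExt τ₁ + normalExt τ₂ := by
  ext1 x
  refine elem_ext fun ξ η => ?_
  rw [inner_normalExt, ContinuousLinearMap.comp_add, map_add, ← inner_normalExt,
    ← inner_normalExt, ← inner_add_right]
  rfl

theorem normalExt_smul (c : ℂ) (τ : M.Elem →L[ℂ] M.Elem) :
    normalExt (c • τ) = c • normalExt τ := by
  ext1 x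
  refine elem_ext fun ξ η => ?_
  rw [inner_normalExt, ContinuousLinearMap.comp_smul, map_smul, ← inner_normalExt, smul_eq_mul,
    ← inner_smul_right]
  rfl

/-- By construction the duality holds for vector functionals. A predual functional is a norm
convergent sum of these, and `x` is norm continuous. -/
theorem apply_comp_eq_normalExt (τ : M.Elem →L[ℂ] M.Elem) {ω : StrongDual ℂ M.Elem}
    (hω : ω ∈ M.predual) (x : Bidual M.Elem) : x (ω ∘L τ) = ω (normalExt τ x) := by
  obtain ⟨ξ, η, hξ, hη, h⟩ := hω
  have h1 := hasSum_vectorFunctional hξ hη h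
  have h2 := (h1.mapL ((ContinuousLinearMap.compL ℂ M.Elem M.Elem ℂ).flip τ)).mapL x
  refine h2.unique ?_
  have h3 := h (normalExt τ x)
  simp_rw [inner_normalExt] at h3
  exact h3

theorem elem_sub_nonneg {a b : M.Elem} : 0 ≤ b - a ↔ a ≤ b :=
  sub_nonneg (a := (b : H →L[ℂ] H)) (b := (a : H →L[ℂ] H))

theorem directedOn_image_of_monotone {α β : Type*} [Preorder α] [Preorder β] {f : α → β}
    (hf : Monotone f) {D : Set α} (hD : DirectedOn (· ≤ ·) D) : DirectedOn (· ≤ ·) (f '' D) := by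
  rintro _ ⟨a, ha, rfl⟩ _ ⟨b, hb, rfl⟩
  obtain ⟨c, hc, hac, hbc⟩ := hD a ha b hb
  exact ⟨f c, ⟨c, hc, rfl⟩, hf hac, hf hbc⟩

theorem tendsto_atTop_image {α β : Type*} [Preorder α] [Preorder β] {f : α → β} (hf : Monotone f)
    (D : Set α) :
    Tendsto (fun d : D => (⟨f d, Set.mem_image_of_mem f d.2⟩ : f '' D)) atTop atTop :=
  tendsto_atTop_atTop_of_monotone (fun _ _ h => hf h) fun ⟨_, a, ha, e⟩ =>
    ⟨⟨a, ha⟩, by subst e; exact le_rfl⟩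

theorem incl_mono : Monotone (Bidual.incl : M.Elem → Bidual M.Elem) := fun a b h ω hω => by
  have := hω (b - a) (elem_sub_nonneg.2 h)
  rwa [map_sub, sub_nonneg] at this

/-- Monotone convergence in `M`: a directed set that is bounded above has a least upper bound,
and converges to it ultraweakly. -/
theorem exists_isLUB_tendsto {D : Set M.Elem} (hne : D.Nonempty) (hD : DirectedOn (· ≤ ·) D)
    {b : M.Elem} (hb : b ∈ upperBounds D) :
    ∃ y, IsLUB D y ∧ ∀ ω ∈ M.predual, Tendsto (fun d : D => ω d) atTop (𝓝 (ω y)) := by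
  -- The limit is taken in `M**` and brought back to `M` by the normal extension of the identity
  -- map.
  obtain ⟨Y, hY⟩ := exists_tendsto_of_directedOn (hne.image Bidual.incl)
    (directedOn_image_of_monotone incl_mono hD) (x := Bidual.incl b)
    (by rintro _ ⟨a, ha, rfl⟩; exact incl_mono (hb ha))
  have : Nonempty D := hne.to_subtype
  have : IsDirectedOrder D := directedOn_iff_isDirectedOrder.1 hD
  have key : ∀ ω ∈ M.predual, Tendsto (fun d : D => ω d) atTop
      (𝓝 (ω (normalExt (ContinuousLinearMap.id ℂ _) Y))) := fun ω hω => by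
    rw [← apply_comp_eq_normalExt _ hω, ContinuousLinearMap.comp_id]
    exact (hY ω).comp (tendsto_atTop_image incl_mono D)
  have key' := fun ξ : H => key _ (vectorFunctional_mem_predual ξ ξ)
  refine ⟨_, ⟨fun d hd => le_iff.2 fun ξ => ?_, fun c hc => le_iff.2 fun ξ => ?_⟩, key⟩
  · refine ge_of_tendsto (key' ξ) ?_
    filter_upwards [eventually_ge_atTop (⟨d, hd⟩ : D)] with d' hd'
    exact le_iff.1 hd' ξ
  · exact le_of_tendsto (key' ξ) (Eventually.of_forall fun d => le_iff.1 (hc d.2) ξ)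

theorem tendsto_of_isLUB {D : Set M.Elem} (hne : D.Nonempty) (hD : DirectedOn (· ≤ ·) D)
    {y : M.Elem} (hy : IsLUB D y) {ω : StrongDual ℂ M.Elem} (hω : ω ∈ M.predual) :
    Tendsto (fun d : D => ω d) atTop (𝓝 (ω y)) := by
  obtain ⟨z, hz, h⟩ := exists_isLUB_tendsto hne hD hy.1
  rw [hy.unique hz]
  exact h ω hω

theorem tendsto_comp_of_scottContinuous {τ : M.Elem →L[ℂ] M.Elem} (hτ : ScottContinuous τ)
    {D : Set M.Elem} (hne : D.Nonempty) (hD : DirectedOn (· ≤ ·) D)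
    {y : M.Elem} (hy : IsLUB D y) {ω : StrongDual ℂ M.Elem} (hω : ω ∈ M.predual) :
    Tendsto (fun d : D => ω (τ d)) atTop (𝓝 (ω (τ y))) :=
  (tendsto_of_isLUB (hne.image τ) (directedOn_image_of_monotone hτ.monotone hD)
    (hτ hne hD hy) hω).comp (tendsto_atTop_image hτ.monotone D)

/-- A positive map whose composition with vector functionals is ultraweakly continuous is
normal. -/
theorem scottContinuous_of_comp_mem_predual {τ : M.Elem →L[ℂ] M.Elem} (hτ : Monotone τ)
    (h : ∀ ξ : H, vectorFunctional ξ ξ ∘L τ ∈ M.predual) : ScottContinuous τ := by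
  intro D hne hD y hy
  have : Nonempty D := hne.to_subtype
  have : IsDirectedOrder D := directedOn_iff_isDirectedOrder.1 hD
  refine ⟨?_, fun c hc => le_iff.2 fun ξ => ?_⟩
  · rintro _ ⟨d, hd, rfl⟩
    exact hτ (hy.1 hd)
  · exact le_of_tendsto (tendsto_of_isLUB hne hD hy (h ξ))
      (Eventually.of_forall fun d => le_iff.1 (hc ⟨d, d.2, rfl⟩) ξ)

/-! ### Complete positivity over finite index types -/

theorem isPosMatrix_iff_fintype {n : ℕ} {ι : Type*} [Fintype ι] (e : ι ≃ Fin n)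
    (a : ι → ι → M.Elem) : IsPosMatrix (Matrix.of fun i j => a (e.symm i) (e.symm j)) ↔
      ∀ ξ : ι → H, 0 ≤ ∑ i, ∑ j, ⟪ξ i, (a i j : H →L[ℂ] H) (ξ j)⟫_ℂ := by
  have key : ∀ ξ : ι → H, ∑ i, ∑ j, ⟪ξ i, (a i j : H →L[ℂ] H) (ξ j)⟫_ℂ =
      ∑ i, ∑ j, ⟪ξ (e.symm i), (a (e.symm i) (e.symm j) : H →L[ℂ] H) (ξ (e.symm j))⟫_ℂ := by
    intro ξ
    rw [← e.symm.sum_comp]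
    exact Finset.sum_congr rfl fun i _ => (e.symm.sum_comp _).symm
  constructor
  · intro h ξ
    rw [key]
    exact h fun i => ξ (e.symm i)
  · intro h ξ
    have := h fun i => ξ (e i)
    rw [key] at this
    simpa using this

theorem IsCP.nonneg_sum {τ : M.Elem →L[ℂ] M.Elem} (hτ : IsCP τ) {ι : Type*} [Fintype ι]
    (a : ι → ι → M.Elem)
    (ha : ∀ ξ : ι → H, 0 ≤ ∑ i, ∑ j, ⟪ξ i, (a i j : H →L[ℂ] H) (ξ j)⟫_ℂ) (ξ : ι → H) :
    0 ≤ ∑ i, ∑ j, ⟪ξ i, (τ (a i j) : H →L[ℂ] H) (ξ j)⟫_ℂ := by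
  have h1 := (isPosMatrix_iff_fintype (Fintype.equivFin ι) a).2 ha
  have h2 := hτ _ _ h1
  exact (isPosMatrix_iff_fintype (Fintype.equivFin ι) fun i j => τ (a i j)).1 h2 ξ

theorem IsCP.nonneg {τ : M.Elem →L[ℂ] M.Elem} (hτ : IsCP τ) {a : M.Elem} (ha : 0 ≤ a) :
    0 ≤ τ a :=
  nonneg_iff.2 fun ξ => by
    have := hτ.nonneg_sum (ι := Unit) (fun _ _ => a)
      (fun ξ => by simpa using nonneg_iff.1 ha (ξ ())) (fun _ => ξ)
    simpa using this

theorem IsCP.monotone {τ : M.Elem →L[ℂ] M.Elem} (hτ : IsCP τ) : Monotone τ := fun a b h => by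
  rw [← elem_sub_nonneg, ← map_sub]
  exact hτ.nonneg (elem_sub_nonneg.2 h)

theorem isPosFunctional_vectorFunctional_comp {τ : M.Elem →L[ℂ] M.Elem} (hτ : IsCP τ) (ξ : H) :
    IsPosFunctional (vectorFunctional ξ ξ ∘L τ) := fun _ ha => nonneg_iff.1 (hτ.nonneg ha) ξ

/-! ### The normal extension -/

theorem isBidualCP_normalExt {τ : M.Elem →L[ℂ] M.Elem} (hτ : IsCP τ) :
    IsBidualCP (normalExt τ) := by
  intro n x hx ξ
  simp only [Matrix.map_apply, inner_normalExt]
  exact hx (fun i j => vectorFunctional (ξ i) (ξ j) ∘L τ) fun a ha => hτ n a ha ξ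

theorem normalExt_mono {τ : M.Elem →L[ℂ] M.Elem} (hτ : IsCP τ) : Monotone (normalExt τ) :=
  fun x y h => le_iff.2 fun ξ => by
    simpa only [inner_normalExt] using h _ (isPosFunctional_vectorFunctional_comp hτ ξ)

theorem scottContinuous_normalExt {τ : M.Elem →L[ℂ] M.Elem} (hτ : IsCP τ) :
    ScottContinuous (normalExt τ) := by
  intro D hne hD x hx
  obtain ⟨Y, hY⟩ := exists_tendsto_of_directedOn hne hD hx.1
  have : Nonempty D := hne.to_subtype
  have : IsDirectedOrder D := directedOn_iff_isDirectedOrder.1 hD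
  refine ⟨?_, fun c hc => le_iff.2 fun ξ => ?_⟩
  · rintro _ ⟨d, hd, rfl⟩
    exact normalExt_mono hτ (hx.1 hd)
  -- The pointwise limit `Y` is an upper bound of `D`, so it dominates `x`; an upper bound of the
  -- image then dominates `τ̃(Y)`.
  · have hxY : x ≤ Y := hx.2 fun d hd => le_of_tendsto_of_directedOn hD hY hd
    refine (le_iff.1 (normalExt_mono hτ hxY) ξ).trans ?_
    rw [inner_normalExt]
    refine le_of_tendsto (hY _) (Eventually.of_forall fun d => ?_)
    have := le_iff.1 (hc ⟨d, d.2, rfl⟩) ξ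
    rwa [inner_normalExt] at this

theorem isNormalExt_normalExt {τ : M.Elem →L[ℂ] M.Elem} (hτ : τ ∈ CP M) :
    IsNormalExt τ (normalExt τ) where
  cp := isBidualCP_normalExt hτ.1
  map_one := (normalExt_incl τ 1).trans hτ.2
  normal := scottContinuous_normalExt hτ.1
  duality _ hω x := apply_comp_eq_normalExt τ hω x

theorem IsNormalExt.eq_normalExt {τ : M.Elem →L[ℂ] M.Elem} {T : Bidual M.Elem →L[ℂ] M.Elem}
    (hT : IsNormalExt τ T) : T = normalExt τ := by
  ext1 x
  refine elem_ext fun ξ η => ?_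
  rw [inner_normalExt, hT.duality _ (vectorFunctional_mem_predual ξ η), vectorFunctional_apply]

/-! ### The Stinespring dilation -/

theorem isSelfAdjoint_of_elem_nonneg {a : M.Elem} (ha : 0 ≤ a) : IsSelfAdjoint a :=
  Subtype.ext (IsSelfAdjoint.of_nonneg (show 0 ≤ (a : H →L[ℂ] H) from ha))

theorem elem_add_norm_nonneg {a : M.Elem} (ha : IsSelfAdjoint a) :
    0 ≤ a + (‖a‖ : ℂ) • (1 : M.Elem) := by
  have ha' : IsSelfAdjoint (a : H →L[ℂ] H) := congrArg Subtype.val ha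
  have := ha'.neg_algebraMap_norm_le_self
  rw [neg_le_iff_add_nonneg] at this
  exact this

theorem elem_zero_le_one : (0 : M.Elem) ≤ 1 := zero_le_one (α := H →L[ℂ] H)

/-- A self-adjoint `a` is the difference of the positive elements `a + ‖a‖1` and `‖a‖1`, so its
image is self-adjoint. -/
theorem IsCP.map_star {τ : M.Elem →L[ℂ] M.Elem} (hτ : IsCP τ) (a : M.Elem) :
    τ (star a) = star (τ a) := by
  have key : ∀ a : M.Elem, IsSelfAdjoint a → star (τ a) = τ a := by
    intro a ha
    have h1 := isSelfAdjoint_of_elem_nonneg (hτ.nonneg (elem_add_norm_nonneg ha))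
    have h2 := isSelfAdjoint_of_elem_nonneg (hτ.nonneg elem_zero_le_one)
    have h3 : τ a = τ (a + (‖a‖ : ℂ) • (1 : M.Elem)) - (‖a‖ : ℂ) • τ 1 := by
      rw [map_add, map_smul, add_sub_cancel_right]
    rw [h3, star_sub, h1.star_eq, star_smul, h2.star_eq]
    simp
  conv_lhs => rw [← realPart_add_I_smul_imaginaryPart a]
  conv_rhs => rw [← realPart_add_I_smul_imaginaryPart a]
  rw [star_add, star_smul, (ℜ a).2.star_eq, (ℑ a).2.star_eq, map_add, map_add, map_smul, map_smul,
    star_add, star_smul, key _ (ℜ a).2, key _ (ℑ a).2]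

/-- The form `(f, g) ↦ ∑ ⟨f a, τ(a⋆ c b) (g b)⟩`. -/
def dilForm (τ : M.Elem →L[ℂ] M.Elem) (f : M.Elem →₀ H) (c : M.Elem) (g : M.Elem →₀ H) : ℂ :=
  f.sum fun a ξ => g.sum fun b η => ⟪ξ, (τ (star a * c * b) : H →L[ℂ] H) η⟫_ℂ

section DilForm

variable (τ : M.Elem →L[ℂ] M.Elem)

theorem dilForm_eq_sum (f g : M.Elem →₀ H) (c : M.Elem) {s t : Finset M.Elem}
    (hs : f.support ⊆ s) (ht : g.support ⊆ t) :
    dilForm τ f c g = ∑ a ∈ s, ∑ b ∈ t, ⟪f a, (τ (star a * c * b) : H →L[ℂ] H) (g b)⟫_ℂ := by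
  rw [dilForm, Finsupp.sum_of_support_subset _ hs _ (by simp)]
  refine Finset.sum_congr rfl fun a _ => ?_
  rw [Finsupp.sum_of_support_subset _ ht _ (by simp)]

theorem dilForm_add_left (f f' g : M.Elem →₀ H) (c : M.Elem) :
    dilForm τ (f + f') c g = dilForm τ f c g + dilForm τ f' c g := by
  classical
  rw [dilForm, Finsupp.sum_add_index']
  · rfl
  · simp
  · intro a ξ ξ'
    simp [Finsupp.sum_add]

theorem dilForm_smul_left (r : ℂ) (f g : M.Elem →₀ H) (c : M.Elem) :
    dilForm τ (r • f) c g = starRingEnd ℂ r * dilForm τ f c g := by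
  rw [dilForm, Finsupp.sum_smul_index' (by simp)]
  simp [dilForm, Finsupp.sum, Finset.mul_sum, mul_comm]

theorem dilForm_add_mid (f g : M.Elem →₀ H) (c d : M.Elem) :
    dilForm τ f (c + d) g = dilForm τ f c g + dilForm τ f d g := by
  simp [dilForm, mul_add, add_mul, Finsupp.sum_add]

theorem dilForm_smul_mid (r : ℂ) (f g : M.Elem →₀ H) (c : M.Elem) :
    dilForm τ f (r • c) g = r * dilForm τ f c g := by
  simp [dilForm, Finsupp.sum, Finset.mul_sum]

/-- Left multiplication by `c` on finitely supported functions `M → H`. -/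
def dilMul (c : M.Elem) : (M.Elem →₀ H) →ₗ[ℂ] (M.Elem →₀ H) :=
  Finsupp.lmapDomain H ℂ (c * ·)

theorem dilForm_dilMul_right (f g : M.Elem →₀ H) (c d : M.Elem) :
    dilForm τ f c (dilMul d g) = dilForm τ f (c * d) g := by
  classical
  refine Finset.sum_congr rfl fun a _ => ?_
  simp only [dilMul, Finsupp.lmapDomain_apply]
  rw [Finsupp.sum_mapDomain_index (by simp) (by simp)]
  simp only [mul_assoc]

theorem dilForm_dilMul_left (f g : M.Elem →₀ H) (c d : M.Elem) :
    dilForm τ (dilMul d f) c g = dilForm τ f (star d * c) g := by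
  classical
  simp only [dilForm, dilMul, Finsupp.lmapDomain_apply]
  rw [Finsupp.sum_mapDomain_index (by simp) (by simp [Finsupp.sum_add])]
  simp only [mul_assoc, star_mul]

variable {τ}

theorem star_dilForm (hτ : IsCP τ) (f g : M.Elem →₀ H) (c : M.Elem) :
    starRingEnd ℂ (dilForm τ f c g) = dilForm τ g (star c) f := by
  classical
  rw [dilForm_eq_sum τ f g c subset_rfl subset_rfl,
    dilForm_eq_sum τ g f _ subset_rfl subset_rfl, Finset.sum_comm]
  simp only [map_sum]
  refine Finset.sum_congr rfl fun a _ => Finset.sum_congr rfl fun b _ => ?_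
  rw [inner_conj_symm, ← ContinuousLinearMap.adjoint_inner_right,
    ← ContinuousLinearMap.star_eq_adjoint]
  have h : star (τ (star b * c * a)) = τ (star a * star c * b) := by
    rw [← hτ.map_star]; simp [mul_assoc]
  rw [← h]
  rfl

/-- If `m` is positive, so is the matrix `a⋆ m_ij b` indexed by the pairs `(i, a)`: apply `m` to the
vectors `∑ a ξ(i, a)`. A general `m` serves to make the amplifications of the dilating
representation positive. -/
theorem dilForm_nonneg (hτ : IsCP τ) {n : ℕ} {m : Matrix (Fin n) (Fin n) M.Elem}
    (hm : IsPosMatrix m) (F : Fin n → M.Elem →₀ H) :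
    0 ≤ ∑ i, ∑ j, dilForm τ (F i) (m i j) (F j) := by
  classical
  let s : Finset M.Elem := Finset.univ.biUnion fun i => (F i).support
  have hs : ∀ i, (F i).support ⊆ s := fun i =>
    Finset.subset_biUnion_of_mem (fun i => (F i).support) (Finset.mem_univ i)
  have h := hτ.nonneg_sum (ι := Fin n × s) (fun x y => star (x.2 : M.Elem) * m x.1 y.1 * y.2)
    (fun ξ => by
      have h1 := hm fun i => ∑ x : s, ((x : M.Elem) : H →L[ℂ] H) (ξ (i, x))
      convert h1 using 1
      rw [Fintype.sum_prod_type]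
      refine Finset.sum_congr rfl fun i _ => ?_
      simp_rw [Fintype.sum_prod_type]
      rw [Finset.sum_comm]
      refine Finset.sum_congr rfl fun j _ => ?_
      rw [map_sum, sum_inner]
      refine Finset.sum_congr rfl fun x _ => ?_
      rw [inner_sum]
      refine Finset.sum_congr rfl fun y _ => ?_
      rw [← ContinuousLinearMap.adjoint_inner_right, ← ContinuousLinearMap.star_eq_adjoint]
      rfl) fun x => F x.1 x.2
  convert h using 1
  rw [Fintype.sum_prod_type]
  refine Finset.sum_congr rfl fun i _ => ?_
  simp_rw [Fintype.sum_prod_type]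
  rw [Finset.sum_comm]
  refine Finset.sum_congr rfl fun j _ => ?_
  rw [dilForm_eq_sum τ _ _ _ (hs i) (hs j), ← Finset.sum_coe_sort s]
  refine Finset.sum_congr rfl fun x _ => ?_
  rw [← Finset.sum_coe_sort s]

theorem dilForm_self_nonneg (hτ : IsCP τ) {c : M.Elem} (hc : 0 ≤ c) (f : M.Elem →₀ H) :
    0 ≤ dilForm τ f c f := by
  have h := dilForm_nonneg hτ (n := 1) (m := fun _ _ => c)
    (fun ξ => by simpa using nonneg_iff.1 hc (ξ 0)) fun _ => f
  simpa using h

end DilForm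

/-- The space of finitely supported functions `M → H` with the semi-inner product
`∑ ⟨f a, τ(a⋆ b) (g b)⟩`. -/
def PreDilation {τ : M.Elem →L[ℂ] M.Elem} (_ : IsCP τ) : Type _ := M.Elem →₀ H

namespace PreDilation

variable {τ : M.Elem →L[ℂ] M.Elem} (hτ : IsCP τ)

instance : AddCommGroup (PreDilation hτ) := inferInstanceAs (AddCommGroup (M.Elem →₀ H))
instance : Module ℂ (PreDilation hτ) := inferInstanceAs (Module ℂ (M.Elem →₀ H))

/-- The underlying finitely supported function. -/
def val : PreDilation hτ ≃ₗ[ℂ] (M.Elem →₀ H) := LinearEquiv.refl ℂ _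

/-- The semi-inner product of the Stinespring construction. -/
abbrev preCore : PreInnerProductSpace.Core ℂ (PreDilation hτ) where
  inner f g := dilForm τ (val hτ f) 1 (val hτ g)
  conj_inner_symm f g := by
    rw [star_dilForm hτ, star_one]
  re_inner_nonneg f :=
    (Complex.nonneg_iff.1 (dilForm_self_nonneg hτ elem_zero_le_one (val hτ f))).1
  add_left f g h := by rw [map_add, dilForm_add_left]
  smul_left f g r := by rw [map_smul, dilForm_smul_left]

instance : SeminormedAddCommGroup (PreDilation hτ) :=
  InnerProductSpace.Core.toSeminormedAddCommGroup (c := preCore hτ)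
instance : InnerProductSpace ℂ (PreDilation hτ) :=
  InnerProductSpace.ofCore (preCore hτ)

theorem inner_def (f g : PreDilation hτ) : ⟪f, g⟫_ℂ = dilForm τ (val hτ f) 1 (val hτ g) := rfl

/-- Positivity of the dilation form at this element says that left multiplication by `c` has norm at
most `‖c‖`. -/
theorem star_mul_self_le (c : M.Elem) :
    0 ≤ ((‖c‖ ^ 2 : ℝ) : ℂ) • (1 : M.Elem) + (-1 : ℂ) • (star c * c) := by
  refine nonneg_iff.2 fun ξ => ?_
  have h1 : (((((‖c‖ ^ 2 : ℝ) : ℂ) • (1 : M.Elem) + (-1 : ℂ) • (star c * c) : M.Elem)) :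
      H →L[ℂ] H) ξ = ((‖c‖ ^ 2 : ℝ) : ℂ) • ξ - (star (c : H →L[ℂ] H)) ((c : H →L[ℂ] H) ξ) := by
    simp [sub_eq_add_neg]
  have h2 : ‖(c : H →L[ℂ] H) ξ‖ ≤ ‖c‖ * ‖ξ‖ := (c : H →L[ℂ] H).le_opNorm ξ
  rw [h1, inner_sub_right, inner_smul_right, ContinuousLinearMap.star_eq_adjoint,
    ContinuousLinearMap.adjoint_inner_right, inner_self_eq_norm_sq_to_K, inner_self_eq_norm_sq_to_K]
  simp only [Complex.coe_algebraMap]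
  rw [sub_nonneg]
  norm_cast
  rw [← mul_pow]
  gcongr

/-- Left multiplication as a linear map. -/
def mulLeftₗ (c : M.Elem) : PreDilation hτ →ₗ[ℂ] PreDilation hτ :=
  (val hτ).symm.toLinearMap ∘ₗ dilMul c ∘ₗ (val hτ).toLinearMap

theorem val_mulLeftₗ (c : M.Elem) (f : PreDilation hτ) :
    val hτ (mulLeftₗ hτ c f) = dilMul c (val hτ f) := rfl

/-- Left multiplication as a bounded operator. -/
def mulLeft (c : M.Elem) : PreDilation hτ →L[ℂ] PreDilation hτ :=
  (mulLeftₗ hτ c).mkContinuous ‖c‖ fun f => by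
    have h := dilForm_self_nonneg hτ (star_mul_self_le c) (val hτ f)
    rw [dilForm_add_mid, dilForm_smul_mid, dilForm_smul_mid] at h
    have h1 : ⟪mulLeftₗ hτ c f, mulLeftₗ hτ c f⟫_ℂ =
        dilForm τ (val hτ f) (star c * c) (val hτ f) := by
      rw [inner_def, val_mulLeftₗ, dilForm_dilMul_right, dilForm_dilMul_left, one_mul]
    rw [← h1, ← inner_def hτ f f, inner_self_eq_norm_sq_to_K, inner_self_eq_norm_sq_to_K] at h
    simp only [Complex.coe_algebraMap] at h
    rw [neg_one_mul, ← sub_eq_add_neg, sub_nonneg] at h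
    norm_cast at h
    rw [← mul_pow] at h
    exact le_of_sq_le_sq h (by positivity)

theorem val_mulLeft (c : M.Elem) (f : PreDilation hτ) :
    val hτ (mulLeft hτ c f) = dilMul c (val hτ f) := rfl

theorem inner_mulLeft (c : M.Elem) (f g : PreDilation hτ) :
    ⟪f, mulLeft hτ c g⟫_ℂ = dilForm τ (val hτ f) c (val hτ g) := by
  rw [inner_def, val_mulLeft, dilForm_dilMul_right, one_mul]

theorem inner_mulLeft_left (c : M.Elem) (f g : PreDilation hτ) :
    ⟪mulLeft hτ c f, g⟫_ℂ = dilForm τ (val hτ f) (star c) (val hτ g) := by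
  rw [inner_def, val_mulLeft, dilForm_dilMul_left, mul_one]

theorem norm_mulLeft_le (c : M.Elem) : ‖mulLeft hτ c‖ ≤ ‖c‖ :=
  LinearMap.mkContinuous_norm_le _ (norm_nonneg _) _

/-- The inclusion `ξ ↦ 1 ⊗ ξ`. -/
def unitTensor : H →ₗ[ℂ] PreDilation hτ := (val hτ).symm.toLinearMap ∘ₗ Finsupp.lsingle 1

theorem dilForm_unitTensor (c : M.Elem) (ξ η : H) :
    dilForm τ (val hτ (unitTensor hτ ξ)) c (val hτ (unitTensor hτ η)) =
      ⟪ξ, (τ c : H →L[ℂ] H) η⟫_ℂ := by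
  change dilForm τ (Finsupp.single 1 ξ) c (Finsupp.single 1 η) = _
  rw [dilForm, Finsupp.sum_single_index (by simp), Finsupp.sum_single_index (by simp)]
  simp

end PreDilation

open UniformSpace Completion PreDilation in
/-- The Stinespring dilation of a completely positive map: a representation `π` of `M` on a
Hilbert space `K`, all of whose amplifications are positive, and a linear map `V : H → K` with
`τ(a) = V⋆ π(a) V`. -/
theorem IsCP.exists_dilation {H : Type u} [NormedAddCommGroup H] [InnerProductSpace ℂ H]
    [CompleteSpace H] {M : VonNeumannAlgebra H} {τ : M.Elem →L[ℂ] M.Elem} (hτ : IsCP τ) :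
    ∃ (K : Type u) (_ : NormedAddCommGroup K) (_ : InnerProductSpace ℂ K) (_ : CompleteSpace K)
      (π : M.Elem →L[ℂ] K →L[ℂ] K) (V : H →ₗ[ℂ] K),
      (∀ a b, π (a * b) = π a * π b) ∧ (∀ a, π (star a) = star (π a)) ∧
      (∀ a ξ η, ⟪V ξ, π a (V η)⟫_ℂ = ⟪ξ, (τ a : H →L[ℂ] H) η⟫_ℂ) ∧
      ∀ (n : ℕ) (a : Matrix (Fin n) (Fin n) M.Elem), IsPosMatrix a → ∀ u : Fin n → K,
        0 ≤ ∑ i, ∑ j, ⟪u i, π (a i j) (u j)⟫_ℂ := by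
  -- Bounded operators are determined by their coefficients on the dense pre-dilation, so each
  -- identity below reduces to one for `dilForm`.
  have ext : ∀ S T : Completion (PreDilation hτ) →L[ℂ] Completion (PreDilation hτ),
      (∀ f g : PreDilation hτ, ⟪(f : Completion (PreDilation hτ)), S g⟫_ℂ =
        ⟪(f : Completion (PreDilation hτ)), T g⟫_ℂ) → S = T := by
    intro S T h
    ext1 y
    refine ext_inner_left ℂ fun x => ?_
    induction x, y using induction_on₂ with
    | hp => apply isClosed_eq <;> fun_prop
    | ih f g => exact h f g
  let π₀ : M.Elem → Completion (PreDilation hτ) →L[ℂ] Completion (PreDilation hτ) :=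
    fun c => (mulLeft hτ c).completion
  have hπ₀ : ∀ c (f : PreDilation hτ), π₀ c f = (mulLeft hτ c f : PreDilation hτ) := fun c f => by
    simp [π₀]
  have hin : ∀ c (f g : PreDilation hτ), ⟪(f : Completion (PreDilation hτ)), π₀ c g⟫_ℂ =
      dilForm τ (val hτ f) c (val hτ g) := fun c f g => by
    rw [hπ₀, Completion.inner_coe, inner_mulLeft]
  let π : M.Elem →L[ℂ] Completion (PreDilation hτ) →L[ℂ] Completion (PreDilation hτ) :=
    LinearMap.mkContinuous
      { toFun := π₀
        map_add' := fun c d => ext _ _ fun f g => by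
          rw [add_apply, inner_add_right, hin, hin, hin, dilForm_add_mid]
        map_smul' := fun r c => ext _ _ fun f g => by
          rw [smul_apply, inner_smul_right, hin, hin, dilForm_smul_mid, RingHom.id_apply] }
      1 fun c => by
        rw [one_mul]
        refine ContinuousLinearMap.opNorm_le_bound _ (norm_nonneg c) fun x => ?_
        induction x using induction_on with
        | hp => apply isClosed_le <;> fun_prop
        | ih f =>
          change ‖π₀ c f‖ ≤ _
          rw [hπ₀, norm_coe, norm_coe]
          exact ((mulLeft hτ c).le_opNorm f).trans (by gcongr; exact norm_mulLeft_le hτ c)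
  have hπ : ∀ c, π c = π₀ c := fun c => rfl
  refine ⟨Completion (PreDilation hτ), inferInstance, inferInstance, inferInstance, π,
    (toComplL (𝕜 := ℂ) (E := PreDilation hτ)).toLinearMap ∘ₗ unitTensor hτ,
    fun a b => ext _ _ fun f g => ?_, fun a => ext _ _ fun f g => ?_, fun a ξ η => ?_,
    fun n a ha u => ?_⟩
  · rw [hπ, hπ, hπ, hin, mul_apply_eq_comp, hπ₀, hin, val_mulLeft,
      dilForm_dilMul_right]
  · rw [hπ, hπ, hin, ContinuousLinearMap.star_eq_adjoint, ContinuousLinearMap.adjoint_inner_right,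
      hπ₀, Completion.inner_coe, inner_mulLeft_left]
  · change ⟪((unitTensor hτ ξ : PreDilation hτ) : Completion (PreDilation hτ)),
      π₀ a ((unitTensor hτ η : PreDilation hτ) : Completion (PreDilation hτ))⟫_ℂ = _
    rw [hin, dilForm_unitTensor]
  · have hd : DenseRange fun (F : Fin n → PreDilation hτ) (i : Fin n) =>
        (F i : Completion (PreDilation hτ)) :=
      DenseRange.piMap fun _ => denseRange_coe
    refine hd.induction_on (p := fun u => 0 ≤ ∑ i, ∑ j, ⟪u i, π (a i j) (u j)⟫_ℂ) u
      (isClosed_le continuous_const (by fun_prop)) fun F => ?_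
    simp only [hπ, hin]
    exact dilForm_nonneg hτ ha fun i => val hτ (F i)

/-! ### Extension of a representation of `M` to the double dual -/

section Representation

variable {K : Type*} [NormedAddCommGroup K] [InnerProductSpace ℂ K]
  (π : M.Elem →L[ℂ] K →L[ℂ] K)

/-- The coefficient functional `a ↦ ⟨u, π(a) v⟩`. -/
def coeffFunctional (u v : K) : StrongDual ℂ M.Elem :=
  innerSL ℂ u ∘L ContinuousLinearMap.apply ℂ K v ∘L π

theorem coeffFunctional_apply (u v : K) (a : M.Elem) : coeffFunctional π u v a = ⟪u, π a v⟫_ℂ :=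
  rfl

theorem norm_coeffFunctional_le (u v : K) : ‖coeffFunctional π u v‖ ≤ ‖π‖ * ‖u‖ * ‖v‖ := by
  refine ContinuousLinearMap.opNorm_le_bound _ (by positivity) fun a => ?_
  rw [coeffFunctional_apply]
  calc _ ≤ ‖u‖ * ‖π a v‖ := norm_inner_le_norm _ _
    _ ≤ ‖u‖ * (‖π‖ * ‖a‖ * ‖v‖) := by gcongr; exact π.le_opNorm₂ a v
    _ = _ := by ring

variable [CompleteSpace K]

/-- The sesquilinear form `(u, v) ↦ ⟨x, ⟨u, π(·) v⟩⟩`. -/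
def bidualForm (x : Bidual M.Elem) : K →L⋆[ℂ] K →L[ℂ] ℂ :=
  LinearMap.mkContinuous₂
    (LinearMap.mk₂'ₛₗ (starRingEnd ℂ) (RingHom.id ℂ) (fun u v : K => x (coeffFunctional π u v))
      (fun u u' v => by
        rw [← map_add]; congr 1; ext a; simp [coeffFunctional_apply])
      (fun c u v => by
        rw [← map_smul]; congr 1; ext a; simp [coeffFunctional_apply, mul_comm])
      (fun u v v' => by
        rw [← map_add]; congr 1; ext a; simp [coeffFunctional_apply])
      (fun c u v => by
        rw [← map_smul]; congr 1; ext a; simp [coeffFunctional_apply]))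
    (‖x‖ * ‖π‖) (fun u v => by
      simp only [LinearMap.mk₂'ₛₗ_apply]
      calc _ ≤ ‖x‖ * ‖coeffFunctional π u v‖ := x.le_opNorm _
        _ ≤ ‖x‖ * (‖π‖ * ‖u‖ * ‖v‖) := by gcongr; exact norm_coeffFunctional_le π u v
        _ = _ := by ring)

/-- The extension of a representation of `M` to `M**`. -/
def bidualRep (x : Bidual M.Elem) : K →L[ℂ] K :=
  ContinuousLinearMap.adjoint (InnerProductSpace.continuousLinearMapOfBilin (bidualForm π x))

theorem inner_bidualRep (x : Bidual M.Elem) (u v : K) :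
    ⟪u, bidualRep π x v⟫_ℂ = x (coeffFunctional π u v) := by
  rw [bidualRep, ContinuousLinearMap.adjoint_inner_right,
    InnerProductSpace.continuousLinearMapOfBilin_apply]
  rfl

theorem bidualRep_incl (a : M.Elem) : bidualRep π (Bidual.incl a) = π a := by
  ext1 v
  exact ext_inner_left ℂ fun u => inner_bidualRep π _ u v

variable {π} (hmul : ∀ a b, π (a * b) = π a * π b) (hstar : ∀ a, π (star a) = star (π a))
include hmul hstar

/-- Because `⟨u, π(ab)v⟩ = ⟨π(a)⋆u, π(b)v⟩`, the action of `x` is absorbed into the right-hand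
vector. This makes the extended representation multiplicative for the Arens product. -/
theorem act_coeffFunctional (x : Bidual M.Elem) (u v : K) :
    x.act (coeffFunctional π u v) = coeffFunctional π u (bidualRep π x v) := by
  ext a
  rw [coeffFunctional_apply, Bidual.act_apply, ← ContinuousLinearMap.adjoint_inner_left,
    inner_bidualRep]
  congr 1
  ext b
  rw [Bidual.rightAct_apply, coeffFunctional_apply, coeffFunctional_apply, hmul,
    ContinuousLinearMap.adjoint_inner_left]
  rfl

theorem bidualRep_mul (x y : Bidual M.Elem) :
    bidualRep π (x * y) = bidualRep π x * bidualRep π y := by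
  ext1 v
  refine ext_inner_left ℂ fun u => ?_
  rw [inner_bidualRep, Bidual.mul_apply, act_coeffFunctional hmul hstar, ← inner_bidualRep]
  rfl

omit hmul in
theorem bidualRep_star (x : Bidual M.Elem) : bidualRep π (star x) = star (bidualRep π x) := by
  ext1 v
  refine ext_inner_left ℂ fun u => ?_
  rw [inner_bidualRep, Bidual.star_apply, ContinuousLinearMap.star_eq_adjoint,
    ContinuousLinearMap.adjoint_inner_right, ← inner_conj_symm, inner_bidualRep]
  change star _ = star _
  congr 2
  ext a
  rw [dualStar_apply, coeffFunctional_apply, coeffFunctional_apply, hstar,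
    ContinuousLinearMap.star_eq_adjoint, ContinuousLinearMap.adjoint_inner_right]
  exact inner_conj_symm _ _

end Representation

/-! ### The central projection -/

section NormalProjection

variable {z₀ : Bidual M.Elem} (hz₀ : IsNormalProjection z₀)
include hz₀

theorem IsNormalProjection.act_mem (ω : StrongDual ℂ M.Elem) : z₀.act ω ∈ M.predual := by
  rw [← hz₀.range_act]
  exact ⟨ω, rfl⟩

theorem IsNormalProjection.act_act (ω : StrongDual ℂ M.Elem) :
    z₀.act (z₀.act ω) = z₀.act ω := by
  rw [← Bidual.act_mul_apply]
  have : z₀ * z₀ = z₀ := hz₀.isStarProjection.isIdempotentElem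
  rw [this]

theorem IsNormalProjection.act_of_mem {ω : StrongDual ℂ M.Elem} (hω : ω ∈ M.predual) :
    z₀.act ω = ω := by
  rw [← hz₀.range_act] at hω
  obtain ⟨ρ, rfl⟩ := hω
  exact hz₀.act_act ρ

theorem IsNormalProjection.apply_of_mem {ω : StrongDual ℂ M.Elem} (hω : ω ∈ M.predual) :
    z₀ ω = ω 1 := by
  rw [← Bidual.act_one, hz₀.act_of_mem hω]

end NormalProjection

/-- The normal part `a ↦ τ̃(i(a) z)` of `τ`. -/
def normalPart (τ : M.Elem →L[ℂ] M.Elem) (z : Bidual M.Elem) : M.Elem →L[ℂ] M.Elem :=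
  normalExt τ ∘L ContinuousLinearMap.flip z.act

theorem normalPart_apply (τ : M.Elem →L[ℂ] M.Elem) (z : Bidual M.Elem) (a : M.Elem) :
    normalPart τ z a = normalExt τ (Bidual.incl a * z) := rfl

/-- For `z = z₀` the right-hand side lies in `z₀ M* = M_*`, which is the source of normality of the
normal part. -/
theorem comp_normalPart (τ : M.Elem →L[ℂ] M.Elem) (z : Bidual M.Elem) {ω : StrongDual ℂ M.Elem}
    (hω : ω ∈ M.predual) : ω ∘L normalPart τ z = z.act (ω ∘L τ) := by
  ext a
  rw [ContinuousLinearMap.comp_apply, normalPart_apply, ← apply_comp_eq_normalExt τ hω,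
    Bidual.incl_mul_apply]

theorem normalPart_one (τ : M.Elem →L[ℂ] M.Elem) (z : Bidual M.Elem) :
    normalPart τ z 1 = normalExt τ z := by
  rw [normalPart_apply]
  congr 1

theorem isCP_of_inner_eq {K : Type*} [NormedAddCommGroup K] [InnerProductSpace ℂ K]
    {π : M.Elem →L[ℂ] K →L[ℂ] K}
    (hpos : ∀ (n : ℕ) (a : Matrix (Fin n) (Fin n) M.Elem), IsPosMatrix a → ∀ u : Fin n → K,
        0 ≤ ∑ i, ∑ j, ⟪u i, π (a i j) (u j)⟫_ℂ)
    {κ : M.Elem →L[ℂ] M.Elem} (W : H → K)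
    (hW : ∀ a ξ η, ⟪ξ, (κ a : H →L[ℂ] H) η⟫_ℂ = ⟪W ξ, π a (W η)⟫_ℂ) : IsCP κ := by
  intro n a ha ξ
  simp only [Matrix.map_apply, hW]
  exact hpos n a ha fun i => W (ξ i)

/-- The dilation of `τ` together with the projection `p` that implements `z₀`. -/
theorem IsNormalProjection.exists_dilation {H : Type u} [NormedAddCommGroup H]
    [InnerProductSpace ℂ H] [CompleteSpace H] {M : VonNeumannAlgebra H} {z₀ : Bidual M.Elem}
    (hz₀ : IsNormalProjection z₀) {τ : M.Elem →L[ℂ] M.Elem} (hτ : IsCP τ) :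
    ∃ (K : Type u) (_ : NormedAddCommGroup K) (_ : InnerProductSpace ℂ K) (_ : CompleteSpace K)
      (π : M.Elem →L[ℂ] K →L[ℂ] K) (W₁ W₂ : H → K),
      (∀ a b, π (a * b) = π a * π b) ∧ (∀ a, π (star a) = star (π a)) ∧
      (∀ (n : ℕ) (a : Matrix (Fin n) (Fin n) M.Elem), IsPosMatrix a → ∀ u : Fin n → K,
        0 ≤ ∑ i, ∑ j, ⟪u i, π (a i j) (u j)⟫_ℂ) ∧
      (∀ a ξ η, ⟪ξ, (normalPart τ z₀ a : H →L[ℂ] H) η⟫_ℂ = ⟪W₁ ξ, π a (W₁ η)⟫_ℂ) ∧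
      (∀ a ξ η, ⟪ξ, ((τ - normalPart τ z₀) a : H →L[ℂ] H) η⟫_ℂ = ⟪W₂ ξ, π a (W₂ η)⟫_ℂ) ∧
      ∀ ξ, bidualRep π z₀ (W₂ ξ) = 0 := by
  obtain ⟨K, _, _, _, π, V, hmul, hstar, hV, hpos⟩ := hτ.exists_dilation
  set p := bidualRep π z₀ with hp
  have hpp : ∀ v, p (p v) = p v := fun v => by
    have h : z₀ * z₀ = z₀ := hz₀.isStarProjection.isIdempotentElem
    change (p * p) v = p v
    rw [hp, ← bidualRep_mul hmul hstar, h]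
  have hps : ∀ u v, ⟪p u, v⟫_ℂ = ⟪u, p v⟫_ℂ := fun u v => by
    have h : star z₀ = z₀ := hz₀.isStarProjection.isSelfAdjoint
    have h1 : star p = p := by rw [hp, ← bidualRep_star hstar, h]
    conv_rhs => rw [← h1]
    rw [ContinuousLinearMap.star_eq_adjoint, ContinuousLinearMap.adjoint_inner_right]
  have hpa : ∀ a v, p (π a v) = π a (p v) := fun a v => by
    change (p * π a) v = (π a * p) v
    rw [← bidualRep_incl π a, hp, ← bidualRep_mul hmul hstar, ← bidualRep_mul hmul hstar,
      hz₀.central]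
  have hτV : ∀ ξ η, vectorFunctional ξ η ∘L τ = coeffFunctional π (V ξ) (V η) := fun ξ η => by
    ext a
    exact (hV a ξ η).symm
  have hn : ∀ a ξ η, ⟪ξ, (normalPart τ z₀ a : H →L[ℂ] H) η⟫_ℂ = ⟪V ξ, π a (p (V η))⟫_ℂ := by
    intro a ξ η
    rw [normalPart_apply, inner_normalExt, Bidual.incl_mul_apply, hτV,
      act_coeffFunctional hmul hstar, coeffFunctional_apply]
  -- The two maps are `W₁ = pV` and `W₂ = (1 - p)V`; the cross terms vanish because `p` is a
  -- projection commuting with `π(M)`.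
  refine ⟨K, inferInstance, inferInstance, inferInstance, π, fun ξ => p (V ξ),
    fun ξ => V ξ - p (V ξ), hmul, hstar, hpos, fun a ξ η => ?_, fun a ξ η => ?_, fun ξ => ?_⟩
  · rw [hn, hps, hpa, hpp]
  · have : ⟪ξ, ((τ - normalPart τ z₀) a : H →L[ℂ] H) η⟫_ℂ =
        ⟪ξ, (τ a : H →L[ℂ] H) η⟫_ℂ - ⟪ξ, (normalPart τ z₀ a : H →L[ℂ] H) η⟫_ℂ := by
      rw [← inner_sub_right]; rfl
    rw [this, hn, ← hV, inner_sub_left, map_sub, inner_sub_right, inner_sub_right, hps, hps, hpa,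
      hpa, hpp]
    ring
  · rw [map_sub, hpp, sub_self]

section NormalPart

variable {z₀ : Bidual M.Elem} (hz₀ : IsNormalProjection z₀) {τ : M.Elem →L[ℂ] M.Elem}
  (hτ : IsCP τ)
include hz₀ hτ

theorem isCP_normalPart : IsCP (normalPart τ z₀) := by
  obtain ⟨K, _, _, _, π, W₁, W₂, hmul, hstar, hpos, h1, h2, h3⟩ := hz₀.exists_dilation hτ
  exact isCP_of_inner_eq hpos W₁ h1

theorem isCP_sub_normalPart : IsCP (τ - normalPart τ z₀) := by
  obtain ⟨K, _, _, _, π, W₁, W₂, hmul, hstar, hpos, h1, h2, h3⟩ := hz₀.exists_dilation hτ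
  exact isCP_of_inner_eq hpos W₂ h2

theorem scottContinuous_normalPart : ScottContinuous (normalPart τ z₀) :=
  scottContinuous_of_comp_mem_predual (isCP_normalPart hz₀ hτ).monotone fun ξ => by
    rw [comp_normalPart τ z₀ (vectorFunctional_mem_predual ξ ξ)]
    exact hz₀.act_mem _

end NormalPart

/-- A completely positive map that vanishes at `1` is zero. -/
theorem IsCP.eq_zero {κ : M.Elem →L[ℂ] M.Elem} (hκ : IsCP κ) (h : κ 1 = 0) : κ = 0 := by
  have hs : ∀ a : M.Elem, IsSelfAdjoint a → κ a = 0 := by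
    intro a ha
    have h1 := hκ.nonneg (elem_add_norm_nonneg ha)
    -- Both `‖a‖1 ± a` are positive and `κ` kills `1`, so `κ(a)` and `-κ(a)` are both positive.
    have h2 := hκ.nonneg (elem_add_norm_nonneg ha.neg)
    rw [map_add, map_smul, h, smul_zero, add_zero] at h1 h2
    rw [map_neg] at h2
    refine le_antisymm ?_ h1
    have : (0 : M.Elem) ≤ 0 - κ a := by simpa using h2
    exact elem_sub_nonneg.1 this
  ext1 a
  rw [← realPart_add_I_smul_imaginaryPart a, map_add, map_smul, hs _ (ℜ a).2, hs _ (ℑ a).2]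
  simp

/-- Self-adjoint elements of `M` approximate `z₀` simultaneously at a vector of `H` and at a
vector killed by `z₀`. -/
theorem IsNormalProjection.exists_approx {K : Type*} [NormedAddCommGroup K]
    [InnerProductSpace ℂ K] [CompleteSpace K] {π : M.Elem →L[ℂ] K →L[ℂ] K}
    {z₀ : Bidual M.Elem} (hz₀ : IsNormalProjection z₀) {w : K} (hw : bidualRep π z₀ w = 0)
    (ζ : H) {δ : ℝ} (hδ : 0 < δ) :
    ∃ b : M.Elem, IsSelfAdjoint b ∧ ‖π b w‖ < δ ∧ ‖(b : H →L[ℂ] H) ζ - ζ‖ < δ := by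
  let L : selfAdjoint M.Elem →ₗ[ℝ] K × H :=
    { toFun := fun b => (π b w, ((b : M.Elem) : H →L[ℂ] H) ζ)
      map_add' := fun b c => by simp
      map_smul' := fun r b => by
        have : ((r • b : selfAdjoint M.Elem) : M.Elem) = (r : ℂ) • (b : M.Elem) := rfl
        rw [this]
        simp }
  have hL : ∀ b, L b = (π b w, ((b : M.Elem) : H →L[ℂ] H) ζ) := fun b => rfl
  -- Hahn-Banach for the real subspace of pairs `(π(b)w, bζ)`, `b` self-adjoint: `z₀` would give the
  -- pair `(0, ζ)`, so no functional can separate it.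
  have hmem : ((0, ζ) : K × H) ∈ (LinearMap.range L).topologicalClosure := by
    by_contra hcon
    obtain ⟨f, u, hf1, hf2⟩ := RCLike.geometric_hahn_banach_closed_point (𝕜 := ℂ)
      (LinearMap.range L).topologicalClosure.convex
      (LinearMap.range L).isClosed_topologicalClosure hcon
    have hf3 : ∀ b, (f (L b)).re < u := fun b =>
      hf1 _ ((LinearMap.range L).le_topologicalClosure ⟨b, rfl⟩)
    have hu : 0 < u := by simpa using hf3 0
    have hf4 : ∀ b, (f (L b)).re = 0 := fun b => by
      by_contra hne
      have h1 := hf3 ((u / (f (L b)).re) • b)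
      have h2 : f ((u / (f (L b)).re) • L b) = ((u / (f (L b)).re : ℝ) : ℂ) * f (L b) := by
        rw [← Complex.coe_smul, ContinuousLinearMap.map_smul, smul_eq_mul]
      rw [map_smul, h2, Complex.re_ofReal_mul, div_mul_cancel₀ _ hne] at h1
      exact lt_irrefl _ h1
    let F₁ : StrongDual ℂ K := f ∘L ContinuousLinearMap.inl ℂ K H
    let F₂ : StrongDual ℂ H := f ∘L ContinuousLinearMap.inr ℂ K H
    let u' := (InnerProductSpace.toDual ℂ K).symm F₁
    let v' := (InnerProductSpace.toDual ℂ H).symm F₂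
    have hf5 : ∀ x y, f (x, y) = ⟪u', x⟫_ℂ + ⟪v', y⟫_ℂ := fun x y => by
      rw [InnerProductSpace.toDual_symm_apply, InnerProductSpace.toDual_symm_apply]
      change _ = f (x, 0) + f (0, y)
      rw [← map_add]
      simp
    let θ : StrongDual ℂ M.Elem := coeffFunctional π u' w + vectorFunctional v' ζ
    have hθ : ∀ b : M.Elem, θ b = f (π b w, (b : H →L[ℂ] H) ζ) := fun b => by
      rw [hf5]; rfl
    -- `θ` is purely imaginary on self-adjoint elements, hence skew-adjoint. As `z₀` is
    -- self-adjoint, `z₀(θ) = f(0, ζ)` has real part zero, contradicting the separation.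
    have hθ' : dualStar θ = -θ := by
      rw [← add_eq_zero_iff_eq_neg]
      have hs : ∀ b : M.Elem, IsSelfAdjoint b → (dualStar θ + θ) b = 0 := fun b hb => by
        have h := hf4 ⟨b, hb⟩
        rw [hL, ← hθ] at h
        rw [add_apply, dualStar_apply, hb.star_eq, Complex.star_def, add_comm, Complex.add_conj, h]
        simp
      ext1 a
      rw [← realPart_add_I_smul_imaginaryPart a, map_add, map_smul, hs _ (ℜ a).2, hs _ (ℑ a).2]
      simp
    have h6 : z₀ θ = ⟪v', ζ⟫_ℂ := by
      rw [map_add, ← inner_bidualRep, hw, inner_zero_right, zero_add,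
        hz₀.apply_of_mem (vectorFunctional_mem_predual v' ζ)]
      rfl
    have h7 : z₀ θ = -star (z₀ θ) := by
      have h : star z₀ = z₀ := hz₀.isStarProjection.isSelfAdjoint
      conv_lhs => rw [← h, Bidual.star_apply, hθ', map_neg, star_neg]
    have h8 : f (0, ζ) = z₀ θ := by rw [hf5, h6, inner_zero_right, zero_add]
    have h9 := congrArg Complex.re h7
    rw [Complex.star_def, Complex.neg_re, Complex.conj_re] at h9
    rw [h8] at hf2
    have : u < (z₀ θ).re := hf2
    linarith
  have hmem' : ((0, ζ) : K × H) ∈ closure (Set.range L) := hmem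
  obtain ⟨_, ⟨b, rfl⟩, hb⟩ := Metric.mem_closure_iff.1 hmem' δ hδ
  rw [hL, dist_comm, Prod.dist_eq, max_lt_iff, dist_eq_norm, dist_eq_norm, sub_zero] at hb
  exact ⟨b, b.2, hb.1, hb.2⟩

/-! ### Resolvents in `M` -/

/-- The element `(1 + a)⁻¹` of `M`. -/
def resolv (a : M.Elem) : M.Elem :=
  ⟨Ring.inverse (1 + (a : H →L[ℂ] H)), by
    change _ ∈ (M : Set (H →L[ℂ] H))
    rw [← M.centralizer_centralizer]
    intro b hb
    have h : (a : H →L[ℂ] H) * b = b * a := hb _ a.2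
    have hc : Commute b (1 + (a : H →L[ℂ] H)) := (Commute.one_right b).add_right h.symm
    -- `Ring.inverse` is `0` off the units, so membership in `M` needs no positivity of `a`.
    by_cases hu : IsUnit (1 + (a : H →L[ℂ] H))
    · obtain ⟨u, hu⟩ := hu
      rw [← hu, Ring.inverse_unit]
      rw [← hu] at hc
      exact hc.units_inv_right
    · rw [Ring.inverse_non_unit _ hu]
      exact Commute.zero_right b⟩

theorem isStrictlyPositive_one_add {a : M.Elem} (ha : 0 ≤ a) :
    IsStrictlyPositive (1 + (a : H →L[ℂ] H)) :=
  isStrictlyPositive_one.add_nonneg (show 0 ≤ (a : H →L[ℂ] H) from ha)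

theorem one_add_mul_resolv {a : M.Elem} (ha : 0 ≤ a) : (1 + a) * resolv a = 1 :=
  Subtype.ext (Ring.mul_inverse_cancel _ (isStrictlyPositive_one_add ha).isUnit)

theorem resolv_mul_one_add {a : M.Elem} (ha : 0 ≤ a) : resolv a * (1 + a) = 1 :=
  Subtype.ext (Ring.inverse_mul_cancel _ (isStrictlyPositive_one_add ha).isUnit)

theorem resolv_zero : resolv (0 : M.Elem) = 1 := by
  have := one_add_mul_resolv (le_refl (0 : M.Elem))
  simpa using this

theorem resolv_antitone {a b : M.Elem} (ha : 0 ≤ a) (hab : a ≤ b) : resolv b ≤ resolv a :=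
  CStarAlgebra.antitoneOn_ringInverse (isStrictlyPositive_one_add ha)
    (isStrictlyPositive_one_add (ha.trans hab))
    (add_le_add_right (show (a : H →L[ℂ] H) ≤ b from hab) 1)

theorem resolv_le_one {a : M.Elem} (ha : 0 ≤ a) : resolv a ≤ 1 := by
  rw [← resolv_zero]
  exact resolv_antitone le_rfl ha

theorem add_resolv_apply {a : M.Elem} (ha : 0 ≤ a) (ζ : H) :
    (resolv a : H →L[ℂ] H) ζ + (a : H →L[ℂ] H) ((resolv a : H →L[ℂ] H) ζ) = ζ := by
  have h := congrArg (fun x : M.Elem => (x : H →L[ℂ] H) ζ) (one_add_mul_resolv ha)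
  simpa [add_mul] using h

theorem inner_resolv {a : M.Elem} (ha : 0 ≤ a) (ζ : H) :
    ⟪ζ, (resolv a : H →L[ℂ] H) ζ⟫_ℂ =
      ⟪(resolv a : H →L[ℂ] H) ζ, (resolv a : H →L[ℂ] H) ζ⟫_ℂ +
      ⟪(resolv a : H →L[ℂ] H) ζ, (a : H →L[ℂ] H) ((resolv a : H →L[ℂ] H) ζ)⟫_ℂ := by
  have hs : IsSelfAdjoint (a : H →L[ℂ] H) := congrArg Subtype.val (isSelfAdjoint_of_elem_nonneg ha)
  have h : ⟪(resolv a : H →L[ℂ] H) ζ, (a : H →L[ℂ] H) ((resolv a : H →L[ℂ] H) ζ)⟫_ℂ =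
      ⟪(a : H →L[ℂ] H) ((resolv a : H →L[ℂ] H) ζ), (resolv a : H →L[ℂ] H) ζ⟫_ℂ := by
    rw [← ContinuousLinearMap.adjoint_inner_left, ← ContinuousLinearMap.star_eq_adjoint,
      hs.star_eq]
  rw [h, ← inner_add_left, add_resolv_apply ha]

theorem resolv_nonneg {a : M.Elem} (ha : 0 ≤ a) : 0 ≤ resolv a := by
  refine nonneg_iff.2 fun ζ => ?_
  rw [inner_resolv ha]
  refine add_nonneg ?_ (nonneg_iff.1 ha _)
  rw [inner_self_eq_norm_sq_to_K]
  simp only [Complex.coe_algebraMap]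
  norm_cast
  positivity

/-- The difference `a - (1 - (1+a)⁻¹)` equals `a (1+a)⁻¹ a`. -/
theorem one_sub_resolv_le {a : M.Elem} (ha : 0 ≤ a) : 1 - resolv a ≤ a := by
  have h1 : a * resolv a = 1 - resolv a := by
    rw [eq_sub_iff_add_eq', ← one_add_mul_resolv ha, add_mul, one_mul]
  have h2 : resolv a * a = 1 - resolv a := by
    rw [eq_sub_iff_add_eq', ← resolv_mul_one_add ha, mul_add, mul_one]
  have h3 : a - (1 - resolv a) = a * resolv a * a := by
    rw [mul_assoc, h2, mul_sub, mul_one, h1]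
  rw [← elem_sub_nonneg, h3]
  have hs : IsSelfAdjoint (a : H →L[ℂ] H) := congrArg Subtype.val (isSelfAdjoint_of_elem_nonneg ha)
  exact hs.conjugate_nonneg (show 0 ≤ (resolv a : H →L[ℂ] H) from resolv_nonneg ha)

/-! ### Normal positive functionals -/

/-- A functional that is continuous along directed sets with a least upper bound. -/
def IsNormalFunctional (ψ : StrongDual ℂ M.Elem) : Prop :=
  ∀ D : Set M.Elem, D.Nonempty → DirectedOn (· ≤ ·) D → ∀ y, IsLUB D y →
    Tendsto (fun d : D => ψ d) atTop (𝓝 (ψ y))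

theorem isNormalFunctional_of_mem_predual {ω : StrongDual ℂ M.Elem} (hω : ω ∈ M.predual) :
    IsNormalFunctional ω := fun _ hne hD _ hy => tendsto_of_isLUB hne hD hy hω

theorem IsPosFunctional.mono {ψ : StrongDual ℂ M.Elem} (hψ : IsPosFunctional ψ) {a b : M.Elem}
    (h : a ≤ b) : (ψ a).re ≤ (ψ b).re := by
  have := (Complex.nonneg_iff.1 (hψ _ (elem_sub_nonneg.2 h))).1
  rw [map_sub, Complex.sub_re] at this
  linarith

theorem IsNormalFunctional.re_le {ψ : StrongDual ℂ M.Elem} (hψ : IsNormalFunctional ψ)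
    {D : Set M.Elem} (hne : D.Nonempty) (hD : DirectedOn (· ≤ ·) D) {y : M.Elem} (hy : IsLUB D y)
    {C : ℝ} (h : ∀ d ∈ D, (ψ d).re ≤ C) : (ψ y).re ≤ C := by
  have : Nonempty D := hne.to_subtype
  have : IsDirectedOrder D := directedOn_iff_isDirectedOrder.1 hD
  exact le_of_tendsto ((Complex.continuous_re.tendsto _).comp (hψ D hne hD y hy))
    (Eventually.of_forall fun d => h d d.2)

theorem re_inner_mono {a b : M.Elem} (h : a ≤ b) (ζ : H) :
    (⟪ζ, (a : H →L[ℂ] H) ζ⟫_ℂ).re ≤ (⟪ζ, (b : H →L[ℂ] H) ζ⟫_ℂ).re :=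
  (Complex.le_def.1 (le_iff.1 h ζ)).1

theorem le_of_re_inner_le {a b : M.Elem} (ha : IsSelfAdjoint a) (hb : IsSelfAdjoint b)
    (h : ∀ ζ, (⟪ζ, (a : H →L[ℂ] H) ζ⟫_ℂ).re ≤ (⟪ζ, (b : H →L[ℂ] H) ζ⟫_ℂ).re) : a ≤ b := by
  have ha' : IsSelfAdjoint (a : H →L[ℂ] H) := congrArg Subtype.val ha
  have hb' : IsSelfAdjoint (b : H →L[ℂ] H) := congrArg Subtype.val hb
  refine le_iff.2 fun ζ => Complex.le_def.2 ⟨h ζ, ?_⟩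
  rw [inner_im_eq_zero ha', inner_im_eq_zero hb']

theorem re_inner_one_sub (a : M.Elem) (ζ : H) :
    (⟪ζ, ((1 - a : M.Elem) : H →L[ℂ] H) ζ⟫_ℂ).re =
      ‖ζ‖ ^ 2 - (⟪ζ, (a : H →L[ℂ] H) ζ⟫_ℂ).re := by
  have : ((1 - a : M.Elem) : H →L[ℂ] H) ζ = ζ - (a : H →L[ℂ] H) ζ := rfl
  rw [this, inner_sub_right, Complex.sub_re, inner_one_re]

/-- Equality case of Cauchy-Schwarz for a contraction: expanding `‖ζ - cζ‖²` gives at most zero. -/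
theorem apply_eq_self_of_le_re_inner {c : M.Elem} (h0 : 0 ≤ c) (h1 : c ≤ 1) {ζ : H}
    (h : ‖ζ‖ ^ 2 ≤ (⟪ζ, (c : H →L[ℂ] H) ζ⟫_ℂ).re) : (c : H →L[ℂ] H) ζ = ζ := by
  have hn : ‖(c : H →L[ℂ] H)‖ ≤ 1 :=
    (CStarAlgebra.norm_le_one_iff_of_nonneg _ (show 0 ≤ (c : H →L[ℂ] H) from h0)).2 h1
  have h2 : ‖(c : H →L[ℂ] H) ζ‖ ≤ ‖ζ‖ :=
    ((c : H →L[ℂ] H).le_opNorm ζ).trans (mul_le_of_le_one_left (norm_nonneg _) hn)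
  have h3 := norm_sub_sq (𝕜 := ℂ) ζ ((c : H →L[ℂ] H) ζ)
  have h4 : ‖(c : H →L[ℂ] H) ζ‖ ^ 2 ≤ ‖ζ‖ ^ 2 := by gcongr
  change _ = ‖ζ‖ ^ 2 - 2 * (⟪ζ, (c : H →L[ℂ] H) ζ⟫_ℂ).re + _ at h3
  have h5 : ‖ζ - (c : H →L[ℂ] H) ζ‖ ^ 2 = 0 := le_antisymm (by linarith) (sq_nonneg _)
  rw [sq_eq_zero_iff, norm_eq_zero, sub_eq_zero] at h5
  exact h5.symm

theorem directedOn_range_of_monotone {f : ℕ → M.Elem} (hf : Monotone f) :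
    DirectedOn (· ≤ ·) (Set.range f) :=
  directedOn_range.2 hf.directed_le

/-! ### Separation from vector functionals forces a normal functional to vanish -/

section Vanishing

variable {ψ : StrongDual ℂ M.Elem} (hpos : IsPosFunctional ψ) (hnorm : IsNormalFunctional ψ)
include hpos hnorm

/-- If `ψ` can be separated approximately from the vector functional of `ζ`, then it can be
separated exactly. -/
theorem exists_separating {ζ : H}
    (h : ∀ δ : ℝ, 0 < δ → ∃ a : M.Elem, 0 ≤ a ∧ (ψ a).re ≤ δ ∧
      (⟪ζ, (resolv a : H →L[ℂ] H) ζ⟫_ℂ).re ≤ δ) :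
    ∃ c : M.Elem, 0 ≤ c ∧ (c : H →L[ℂ] H) ζ = ζ ∧ (ψ c).re ≤ 0 := by
  choose a ha0 haψ haζ using fun n : ℕ => h ((1 / 2) ^ n) (by positivity)
  -- `S N m` is a partial sum of the tail starting at `N`. Its value under `ψ` is at most the
  -- geometric tail `2 · 2⁻ᴺ`.
  let S : ℕ → ℕ → M.Elem := fun N m => ∑ k ∈ Finset.range m, a (N + k)
  have hadd : ∀ {x y : M.Elem}, 0 ≤ y → x ≤ x + y := fun {x y} hy =>
    le_add_of_nonneg_right (α := H →L[ℂ] H) (a := x) hy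
  have hadd' : ∀ {x y : M.Elem}, 0 ≤ y → x ≤ y + x := fun {x y} hy => by
    rw [add_comm]; exact hadd hy
  have hS1 : ∀ N m, S N (m + 1) = S N m + a (N + m) := fun N m => Finset.sum_range_succ _ _
  have hS0 : ∀ N m, 0 ≤ S N m := fun N m => by
    induction m with
    | zero => exact le_rfl
    | succ m ih => rw [hS1]; exact ih.trans (hadd (ha0 _))
  have hSm : ∀ N, Monotone (S N) := fun N => monotone_nat_of_le_succ fun m => by
    rw [hS1]; exact hadd (ha0 _)
  have hSN : ∀ N m, S (N + 1) m ≤ S N (m + 1) := fun N m => by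
    have : S N (m + 1) = a N + S (N + 1) m := by
      simp only [S, Finset.sum_range_succ']
      rw [add_comm]
      congr 1
      exact Finset.sum_congr rfl fun k _ => by rw [add_right_comm, add_assoc]
    rw [this]
    exact hadd' (ha0 N)
  have hSψ : ∀ N m, (ψ (S N m)).re ≤ 2 * (1 / 2) ^ N := fun N m => by
    have h1 : ∀ m, (ψ (S N m)).re ≤ 2 * (1 / 2) ^ N - 2 * (1 / 2) ^ (N + m) := fun m => by
      induction m with
      | zero => simp [S]
      | succ m ih =>
        rw [hS1, map_add, Complex.add_re]
        have := haψ (N + m)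
        rw [← add_assoc, pow_succ]
        linarith
    exact (h1 m).trans (by simp)
  -- The sums may diverge, but their transforms `1 - (1+S)⁻¹` increase, stay below `1` and below
  -- `S`, so their suprema `c N` exist.
  let d : ℕ → ℕ → M.Elem := fun N m => 1 - resolv (S N m)
  have hsub : ∀ {x y : M.Elem}, x ≤ y → 1 - y ≤ 1 - x := fun {x y} hxy =>
    sub_le_sub_left (show (x : H →L[ℂ] H) ≤ y from hxy) 1
  have hdm : ∀ N, Monotone (d N) := fun N m m' hm =>
    hsub (resolv_antitone (hS0 N m) (hSm N hm))
  have hd1 : ∀ N m, d N m ≤ 1 := fun N m =>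
    sub_le_self (1 : H →L[ℂ] H) (show 0 ≤ (resolv (S N m) : H →L[ℂ] H) from
      resolv_nonneg (hS0 N m))
  have hd0 : ∀ N m, 0 ≤ d N m := fun N m => elem_sub_nonneg.2 (resolv_le_one (hS0 N m))
  have hdψ : ∀ N m, (ψ (d N m)).re ≤ 2 * (1 / 2) ^ N := fun N m =>
    (hpos.mono (one_sub_resolv_le (hS0 N m))).trans (hSψ N m)
  choose c hc _ using fun N => exists_isLUB_tendsto (Set.range_nonempty (d N))
    (directedOn_range_of_monotone (hdm N)) (b := 1) (by rintro _ ⟨m, rfl⟩; exact hd1 N m)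
  have hc1 : ∀ N, c N ≤ 1 := fun N => (hc N).2 (by rintro _ ⟨m, rfl⟩; exact hd1 N m)
  have hc0 : ∀ N, 0 ≤ c N := fun N => (hd0 N 0).trans ((hc N).1 ⟨0, rfl⟩)
  have hcψ : ∀ N, (ψ (c N)).re ≤ 2 * (1 / 2) ^ N := fun N =>
    hnorm.re_le (Set.range_nonempty (d N)) (directedOn_range_of_monotone (hdm N)) (hc N)
      (by rintro _ ⟨m, rfl⟩; exact hdψ N m)
  have hcanti : ∀ N, c (N + 1) ≤ c N := fun N => (hc (N + 1)).2 (by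
    rintro _ ⟨m, rfl⟩
    exact (hsub (resolv_antitone (hS0 _ _) (hSN N m))).trans ((hc N).1 ⟨m + 1, rfl⟩))
  -- `S N (m+1)` dominates the single term `a (N+m)`, whose resolvent at `ζ` is at most `2⁻ᵐ`.
  have hcζ : ∀ N, ‖ζ‖ ^ 2 ≤ (⟪ζ, (c N : H →L[ℂ] H) ζ⟫_ℂ).re := fun N => by
    have h1 : ∀ m : ℕ, ‖ζ‖ ^ 2 - (1 / 2) ^ m ≤ (⟪ζ, (c N : H →L[ℂ] H) ζ⟫_ℂ).re := fun m => by
      refine le_trans ?_ (re_inner_mono ((hc N).1 ⟨m + 1, rfl⟩) ζ)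
      rw [re_inner_one_sub]
      have h2 : resolv (S N (m + 1)) ≤ resolv (a (N + m)) :=
        resolv_antitone (ha0 _) (by rw [hS1]; exact hadd' (hS0 N m))
      have h3 := (re_inner_mono h2 ζ).trans (haζ (N + m))
      have h4 : (1 / 2 : ℝ) ^ (N + m) ≤ (1 / 2) ^ m :=
        pow_le_pow_of_le_one (by norm_num) (by norm_num) (by omega)
      linarith
    have h2 : Tendsto (fun m : ℕ => ‖ζ‖ ^ 2 - (1 / 2 : ℝ) ^ m) atTop (𝓝 (‖ζ‖ ^ 2 - 0)) :=
      tendsto_const_nhds.sub (tendsto_pow_atTop_nhds_zero_of_lt_one (by norm_num) (by norm_num))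
    rw [sub_zero] at h2
    exact le_of_tendsto' h2 h1
  -- The witness is the infimum of the decreasing sequence `c N`, obtained as `1 - e` with `e` the
  -- supremum of `1 - c N`.
  have hem : Monotone fun N => 1 - c N := monotone_nat_of_le_succ fun N => hsub (hcanti N)
  obtain ⟨e, he, -⟩ := exists_isLUB_tendsto (Set.range_nonempty fun N => 1 - c N)
    (directedOn_range_of_monotone hem) (b := 1) (by
      rintro _ ⟨N, rfl⟩
      exact sub_le_self (1 : H →L[ℂ] H) (show 0 ≤ (c N : H →L[ℂ] H) from hc0 N))
  have he1 : e ≤ 1 := he.2 (by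
      rintro _ ⟨N, rfl⟩
      exact sub_le_self (1 : H →L[ℂ] H) (show 0 ≤ (c N : H →L[ℂ] H) from hc0 N))
  have he0 : 0 ≤ e := le_trans (elem_sub_nonneg.2 (hc1 0)) (he.1 ⟨0, rfl⟩)
  have hle : ∀ N, 1 - e ≤ c N := fun N =>
    sub_le_comm.1 (show (1 : H →L[ℂ] H) - c N ≤ e from he.1 ⟨N, rfl⟩)
  have heζ : (⟪ζ, (e : H →L[ℂ] H) ζ⟫_ℂ).re ≤ 0 :=
    (isNormalFunctional_of_mem_predual (vectorFunctional_mem_predual ζ ζ)).re_le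
      (Set.range_nonempty _) (directedOn_range_of_monotone hem) he (by
        rintro _ ⟨N, rfl⟩
        change (⟪ζ, ((1 - c N : M.Elem) : H →L[ℂ] H) ζ⟫_ℂ).re ≤ 0
        rw [re_inner_one_sub]
        linarith [hcζ N])
  refine ⟨1 - e, elem_sub_nonneg.2 he1, apply_eq_self_of_le_re_inner (elem_sub_nonneg.2 he1)
    (sub_le_self (1 : H →L[ℂ] H) (show 0 ≤ (e : H →L[ℂ] H) from he0)) ?_, ?_⟩
  · rw [re_inner_one_sub]
    linarith
  · have h2 : Tendsto (fun N : ℕ => 2 * (1 / 2 : ℝ) ^ N) atTop (𝓝 (2 * 0)) :=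
      (tendsto_pow_atTop_nhds_zero_of_lt_one (by norm_num) (by norm_num)).const_mul 2
    rw [mul_zero] at h2
    exact ge_of_tendsto' h2 fun N => (hpos.mono (hle N)).trans (hcψ N)

/-- A normal positive functional that can be separated from every vector functional vanishes. -/
theorem re_apply_one_le_zero
    (h : ∀ (ζ : H) (δ : ℝ), 0 < δ → ∃ a : M.Elem, 0 ≤ a ∧ (ψ a).re ≤ δ ∧
      (⟪ζ, (resolv a : H →L[ℂ] H) ζ⟫_ℂ).re ≤ δ) : (ψ 1).re ≤ 0 := by
  -- `N` is closed under addition, so its bounded transforms form a directed set below `1`. Its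
  -- supremum `P` plays the role of the largest projection on which `ψ` vanishes; the goal is `P ≥
  -- 1`.
  let N : Set M.Elem := {a | 0 ≤ a ∧ (ψ a).re ≤ 0}
  let D : Set M.Elem := (fun a => 1 - resolv a) '' N
  have hsub : ∀ {x y : M.Elem}, x ≤ y → 1 - y ≤ 1 - x := fun {x y} hxy =>
    sub_le_sub_left (show (x : H →L[ℂ] H) ≤ y from hxy) 1
  have hne : D.Nonempty := ⟨_, 0, ⟨le_rfl, by simp⟩, rfl⟩
  have hD : DirectedOn (· ≤ ·) D := by
    rintro _ ⟨a, ⟨ha, ha'⟩, rfl⟩ _ ⟨b, ⟨hb, hb'⟩, rfl⟩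
    have h1 : a ≤ a + b := le_add_of_nonneg_right (α := H →L[ℂ] H) (a := a) hb
    have h2 : b ≤ a + b := le_add_of_nonneg_left (α := H →L[ℂ] H) (a := b) ha
    exact ⟨_, ⟨a + b, ⟨ha.trans h1, by rw [map_add, Complex.add_re]; linarith⟩, rfl⟩,
      hsub (resolv_antitone ha h1), hsub (resolv_antitone hb h2)⟩
  have hD1 : (1 : M.Elem) ∈ upperBounds D := by
    rintro _ ⟨a, ⟨ha, -⟩, rfl⟩
    exact sub_le_self (1 : H →L[ℂ] H) (show 0 ≤ (resolv a : H →L[ℂ] H) from resolv_nonneg ha)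
  obtain ⟨P, hP, -⟩ := exists_isLUB_tendsto hne hD hD1
  have hP0 : 0 ≤ P := by
    have := hP.1 ⟨0, ⟨le_rfl, by simp⟩, rfl⟩
    simpa [resolv_zero] using this
  have hPψ : (ψ P).re ≤ 0 := hnorm.re_le hne hD hP (by
    rintro _ ⟨a, ⟨ha, ha'⟩, rfl⟩
    exact (hpos.mono (one_sub_resolv_le ha)).trans ha')
  refine (hpos.mono (le_of_re_inner_le (.one _) (isSelfAdjoint_of_elem_nonneg hP0)
    fun ζ => ?_)).trans hPψ
  obtain ⟨c, hc0, hcζ, hcψ⟩ := exists_separating hpos hnorm (h ζ)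
  -- All multiples `n c` lie in `N`, and the resolvent of `n c` sends `ζ` to `ζ / (n + 1)`.
  have key : ∀ n : ℕ, ‖ζ‖ ^ 2 - 1 / ((n : ℝ) + 1) * ‖ζ‖ ^ 2 ≤ (⟪ζ, (P : H →L[ℂ] H) ζ⟫_ℂ).re := by
    intro n
    have hn0 : 0 ≤ (n : ℂ) • c := by
      refine nonneg_iff.2 fun ξ => ?_
      have : (((n : ℂ) • c : M.Elem) : H →L[ℂ] H) ξ = (n : ℂ) • (c : H →L[ℂ] H) ξ := rfl
      rw [this, inner_smul_right]
      exact mul_nonneg (Nat.cast_nonneg n) (nonneg_iff.1 hc0 ξ)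
    have hmem : (n : ℂ) • c ∈ N := ⟨hn0, by
      rw [map_smul, smul_eq_mul, ← Complex.ofReal_natCast, Complex.re_ofReal_mul]
      exact mul_nonpos_of_nonneg_of_nonpos (Nat.cast_nonneg n) hcψ⟩
    refine le_trans ?_ (re_inner_mono (hP.1 ⟨_, hmem, rfl⟩) ζ)
    have h1 : (resolv ((n : ℂ) • c) : H →L[ℂ] H) (((n : ℂ) + 1) • ζ) = ζ := by
      have h2 := congrArg (fun x : M.Elem => (x : H →L[ℂ] H) ζ) (resolv_mul_one_add hn0)
      have h3 : (((1 + (n : ℂ) • c : M.Elem)) : H →L[ℂ] H) ζ = ((n : ℂ) + 1) • ζ := by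
        change ζ + (n : ℂ) • (c : H →L[ℂ] H) ζ = _
        rw [hcζ]; module
      change (resolv ((n : ℂ) • c) : H →L[ℂ] H) ((((1 + (n : ℂ) • c : M.Elem)) : H →L[ℂ] H) ζ) = ζ
        at h2
      rwa [h3] at h2
    have hn1 : ((n : ℂ) + 1) ≠ 0 := Nat.cast_add_one_ne_zero n
    have h4 : (resolv ((n : ℂ) • c) : H →L[ℂ] H) ζ = ((1 / ((n : ℝ) + 1) : ℝ) : ℂ) • ζ := by
      rw [map_smul] at h1
      conv_rhs => rw [← h1]
      rw [smul_smul]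
      push_cast
      rw [one_div, inv_mul_cancel₀ hn1, one_smul]
    rw [re_inner_one_sub, h4, inner_smul_right, Complex.re_ofReal_mul, inner_one_re]
  have ht : Tendsto (fun n : ℕ => ‖ζ‖ ^ 2 - 1 / ((n : ℝ) + 1) * ‖ζ‖ ^ 2) atTop
      (𝓝 (‖ζ‖ ^ 2 - 0 * ‖ζ‖ ^ 2)) :=
    tendsto_const_nhds.sub (tendsto_one_div_add_atTop_nhds_zero_nat.mul_const _)
  rw [zero_mul, sub_zero] at ht
  have hone : (⟪ζ, ((1 : M.Elem) : H →L[ℂ] H) ζ⟫_ℂ).re = ‖ζ‖ ^ 2 := inner_one_re ζ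
  rw [hone]
  exact le_of_tendsto' ht key

end Vanishing

/-! ### Normal maps satisfy `τ̃(z₀) = 1` -/

theorem re_inner_smul_mul_self {b : M.Elem} (hb : IsSelfAdjoint b) (r : ℝ) (η : H) :
    ⟪η, (((r : ℂ) • (b * b) : M.Elem) : H →L[ℂ] H) η⟫_ℂ =
      ((r * ‖(b : H →L[ℂ] H) η‖ ^ 2 : ℝ) : ℂ) := by
  have hs : IsSelfAdjoint (b : H →L[ℂ] H) := congrArg Subtype.val hb
  have : (((r : ℂ) • (b * b) : M.Elem) : H →L[ℂ] H) η =
    (r : ℂ) • (b : H →L[ℂ] H) ((b : H →L[ℂ] H) η) := rfl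
  rw [this, inner_smul_right, ← ContinuousLinearMap.adjoint_inner_left,
    ← ContinuousLinearMap.star_eq_adjoint, hs.star_eq, inner_self_eq_norm_sq_to_K]
  simp

theorem smul_mul_self_nonneg {b : M.Elem} (hb : IsSelfAdjoint b) {r : ℝ} (hr : 0 ≤ r) :
    0 ≤ (r : ℂ) • (b * b) := nonneg_iff.2 fun η => by
  rw [re_inner_smul_mul_self hb]
  exact_mod_cast mul_nonneg hr (sq_nonneg _)

/-- If a self-adjoint `b` almost fixes `ζ`, then the resolvent of a large multiple of `b²` is small
at `ζ`. -/
theorem re_inner_resolv_smul_mul_self_le {b : M.Elem} (hb : IsSelfAdjoint b) {s : ℝ} (hs : 0 < s)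
    (ζ : H) :
    (⟪ζ, (resolv (((s ^ 2)⁻¹ : ℝ) • (b * b) : M.Elem) : H →L[ℂ] H) ζ⟫_ℂ).re ≤
      s * ‖ζ‖ ^ 2 + ‖(b : H →L[ℂ] H) ζ - ζ‖ * ‖ζ‖ := by
  have hsa : IsSelfAdjoint (b : H →L[ℂ] H) := congrArg Subtype.val hb
  have hr : (((s ^ 2)⁻¹ : ℝ) • (b * b) : M.Elem) = (((s ^ 2)⁻¹ : ℝ) : ℂ) • (b * b) := rfl
  have ha := smul_mul_self_nonneg hb (inv_nonneg.2 (sq_nonneg s))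
  rw [hr]
  set η := (resolv ((((s ^ 2)⁻¹ : ℝ) : ℂ) • (b * b) : M.Elem) : H →L[ℂ] H) ζ with hη
  have h1 : (⟪ζ, η⟫_ℂ).re = ‖η‖ ^ 2 + (s ^ 2)⁻¹ * ‖(b : H →L[ℂ] H) η‖ ^ 2 := by
    rw [hη, inner_resolv ha, Complex.add_re, inner_one_re, re_inner_smul_mul_self hb,
      Complex.ofReal_re]
  have h2 : (⟪ζ, η⟫_ℂ).re ≤ ‖ζ‖ * ‖η‖ :=
    (Complex.re_le_norm _).trans (norm_inner_le_norm ζ η)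
  have h3 : 0 ≤ (s ^ 2)⁻¹ * ‖(b : H →L[ℂ] H) η‖ ^ 2 := by positivity
  have h4 : ‖η‖ ≤ ‖ζ‖ := by
    by_contra hlt
    push Not at hlt
    nlinarith [norm_nonneg ζ, norm_nonneg η]
  have h5 : ‖(b : H →L[ℂ] H) η‖ ≤ s * ‖ζ‖ := by
    have h6 : (s ^ 2)⁻¹ * ‖(b : H →L[ℂ] H) η‖ ^ 2 ≤ ‖ζ‖ ^ 2 := by
      nlinarith [norm_nonneg ζ, norm_nonneg η, sq_nonneg ‖η‖]
    rw [inv_mul_le_iff₀ (by positivity), ← mul_pow] at h6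
    exact le_of_sq_le_sq h6 (by positivity)
  -- The first term is small because `‖bη‖ ≤ s‖ζ‖`, the second because `b` almost fixes `ζ`.
  have h7 : ⟪ζ, η⟫_ℂ = ⟪ζ, (b : H →L[ℂ] H) η⟫_ℂ - ⟪(b : H →L[ℂ] H) ζ - ζ, η⟫_ℂ := by
    have : ⟪ζ, (b : H →L[ℂ] H) η⟫_ℂ = ⟪(b : H →L[ℂ] H) ζ, η⟫_ℂ := by
      rw [← ContinuousLinearMap.adjoint_inner_left, ← ContinuousLinearMap.star_eq_adjoint,
        hsa.star_eq]
    rw [this, inner_sub_left, sub_sub_cancel]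
  have h8 : (⟪ζ, (b : H →L[ℂ] H) η⟫_ℂ).re ≤ ‖ζ‖ * (s * ‖ζ‖) :=
    (Complex.re_le_norm _).trans ((norm_inner_le_norm _ _).trans (by gcongr))
  have h9 : -(⟪(b : H →L[ℂ] H) ζ - ζ, η⟫_ℂ).re ≤ ‖(b : H →L[ℂ] H) ζ - ζ‖ * ‖ζ‖ :=
    (neg_le_abs _).trans ((Complex.abs_re_le_norm _).trans
      ((norm_inner_le_norm _ _).trans (by gcongr)))
  rw [h7, Complex.sub_re]
  linarith

/-- The normal extension of a normal map sends `z₀` to `1`. -/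
theorem normalExt_eq_one_of_scottContinuous {z₀ : Bidual M.Elem} (hz₀ : IsNormalProjection z₀)
    {τ : M.Elem →L[ℂ] M.Elem} (hτ : τ ∈ CP M) (hn : ScottContinuous τ) :
    normalExt τ z₀ = 1 := by
  obtain ⟨K, _, _, _, π, W₁, W, hmul, hstar, -, -, hW, hW0⟩ := hz₀.exists_dilation hτ.1
  have hcp := isCP_sub_normalPart hz₀ hτ.1
  have key : ∀ ξ : H, (⟪ξ, ((τ - normalPart τ z₀) 1 : H →L[ℂ] H) ξ⟫_ℂ).re ≤ 0 := by
    intro ξ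
    refine re_apply_one_le_zero (ψ := vectorFunctional ξ ξ ∘L (τ - normalPart τ z₀))
      (isPosFunctional_vectorFunctional_comp hcp ξ) (fun D hne hD y hy => ?_) fun ζ δ hδ => ?_
    · simp only [ContinuousLinearMap.comp_apply, sub_apply, map_sub]
      exact (tendsto_comp_of_scottContinuous hn hne hD hy (vectorFunctional_mem_predual ξ ξ)).sub
        (tendsto_comp_of_scottContinuous (scottContinuous_normalPart hz₀ hτ.1) hne hD hy
          (vectorFunctional_mem_predual ξ ξ))
    -- The separating element is `s⁻² b²`. The choice of `s` and then `ε` makes `s‖ζ‖²` and `ε‖ζ‖`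
    -- at most `δ/2` and `s⁻²ε²` at most `δ`; the factor `min 1 δ` enters because its square is at
    -- most `δ`.
    · set s : ℝ := δ / (2 * (‖ζ‖ ^ 2 + 1)) with hs
      have hs0 : 0 < s := by positivity
      have hs1 : s * ‖ζ‖ ^ 2 ≤ δ / 2 := by
        rw [hs, div_mul_eq_mul_div, div_le_div_iff₀ (by positivity) (by positivity)]
        nlinarith [sq_nonneg ‖ζ‖]
      set ε : ℝ := min (δ / (2 * (‖ζ‖ + 1))) (s * min 1 δ) with hε
      have hε0 : 0 < ε := lt_min (by positivity) (mul_pos hs0 (lt_min one_pos hδ))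
      have hε1 : ε * ‖ζ‖ ≤ δ / 2 := by
        calc ε * ‖ζ‖ ≤ δ / (2 * (‖ζ‖ + 1)) * ‖ζ‖ := by gcongr; exact min_le_left _ _
          _ ≤ δ / 2 := by
            rw [div_mul_eq_mul_div, div_le_div_iff₀ (by positivity) (by positivity)]
            nlinarith [norm_nonneg ζ]
      have hε2 : (s ^ 2)⁻¹ * ε ^ 2 ≤ δ := by
        have hm0 : 0 < min 1 δ := lt_min one_pos hδ
        rw [inv_mul_le_iff₀ (by positivity)]
        calc ε ^ 2 ≤ (s * min 1 δ) ^ 2 := by gcongr; exact min_le_right _ _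
          _ = s ^ 2 * (min 1 δ * min 1 δ) := by ring
          _ ≤ s ^ 2 * (1 * δ) := by
            gcongr
            · exact min_le_left _ _
            · exact min_le_right _ _
          _ = s ^ 2 * δ := by ring
      obtain ⟨b, hb, hb1, hb2⟩ := hz₀.exists_approx (hW0 ξ) ζ hε0
      refine ⟨_, smul_mul_self_nonneg hb (inv_nonneg.2 (sq_nonneg s)), ?_, ?_⟩
      · have h1 : (vectorFunctional ξ ξ ∘L (τ - normalPart τ z₀))
            ((((s ^ 2)⁻¹ : ℝ) : ℂ) • (b * b)) =
            (((s ^ 2)⁻¹ : ℝ) : ℂ) * ⟪W ξ, π (b * b) (W ξ)⟫_ℂ := by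
          rw [map_smul, smul_eq_mul, ← hW]
          rfl
        have h2 : ⟪W ξ, π (b * b) (W ξ)⟫_ℂ = ⟪π b (W ξ), π b (W ξ)⟫_ℂ := by
          have h3 : star (π b) = π b := by rw [← hstar, hb.star_eq]
          rw [hmul]
          conv_rhs => rw [← ContinuousLinearMap.adjoint_inner_right,
            ← ContinuousLinearMap.star_eq_adjoint, h3]
          rfl
        have h4 : (⟪π b (W ξ), π b (W ξ)⟫_ℂ).re = ‖π b (W ξ)‖ ^ 2 := by
          rw [inner_self_eq_norm_sq_to_K]; norm_cast
        rw [h1, h2, Complex.re_ofReal_mul, h4]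
        exact le_trans (by gcongr) hε2
      · refine (re_inner_resolv_smul_mul_self_le hb hs0 ζ).trans ?_
        have : ‖(b : H →L[ℂ] H) ζ - ζ‖ * ‖ζ‖ ≤ ε * ‖ζ‖ := by gcongr
        linarith
  have h0 := hcp.nonneg elem_zero_le_one
  have h1 : (τ - normalPart τ z₀) 1 ≤ 0 :=
    le_of_re_inner_le (isSelfAdjoint_of_elem_nonneg h0) (.zero _) fun ξ => by
      simpa using key ξ
  have h2 : (τ - normalPart τ z₀) 1 = 0 := le_antisymm h1 h0
  rw [sub_apply, hτ.2, normalPart_one, sub_eq_zero] at h2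
  exact h2.symm

/-! ### Convex combinations -/

theorem IsCP.smul {τ : M.Elem →L[ℂ] M.Elem} (hτ : IsCP τ) {r : ℝ} (hr : 0 ≤ r) :
    IsCP ((r : ℂ) • τ) := by
  intro n a ha ξ
  have h : ∑ i, ∑ j, ⟪ξ i, (((r : ℂ) • τ) (a i j) : H →L[ℂ] H) (ξ j)⟫_ℂ =
      (r : ℂ) * ∑ i, ∑ j, ⟪ξ i, (τ (a i j) : H →L[ℂ] H) (ξ j)⟫_ℂ := by
    simp_rw [Finset.mul_sum]
    refine Finset.sum_congr rfl fun i _ => Finset.sum_congr rfl fun j _ => ?_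
    rw [← inner_smul_right]
    rfl
  simp only [Matrix.map_apply]
  rw [h]
  exact mul_nonneg (by exact_mod_cast hr) (hτ n a ha ξ)

/-- Singularity tested at `x = 1` is the condition at `z₀`. Conversely, the normal part is
completely positive with value `τ̃(z₀)` at `1`, so it vanishes once this value does. -/
theorem mem_CPs_iff {z₀ : Bidual M.Elem} (hz₀ : IsNormalProjection z₀)
    {τ : M.Elem →L[ℂ] M.Elem} (hτ : τ ∈ CP M) : τ ∈ CPs z₀ ↔ normalExt τ z₀ = 0 := by
  constructor
  · intro h
    refine elem_ext fun ξ η => ?_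
    have h1 := h.2 _ (vectorFunctional_mem_predual ξ η) 1
    rw [Bidual.mul_incl_one] at h1
    rw [inner_normalExt, h1]
    simp
  · intro h
    refine ⟨hτ, fun ω hω x => ?_⟩
    have h1 : normalPart τ z₀ = 0 :=
      (isCP_normalPart hz₀ hτ.1).eq_zero (by rw [normalPart_one, h])
    rw [hz₀.central, Bidual.incl_mul_apply, ← comp_normalPart τ z₀ hω, h1]
    simp

theorem mem_CPσ_of_normalExt_eq_one {z₀ : Bidual M.Elem} (hz₀ : IsNormalProjection z₀)
    {τ : M.Elem →L[ℂ] M.Elem} (hτ : τ ∈ CP M) (h : normalExt τ z₀ = 1) : τ ∈ CPσ M := by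
  have h1 : τ - normalPart τ z₀ = 0 := (isCP_sub_normalPart hz₀ hτ.1).eq_zero (by
    rw [sub_apply, hτ.2, normalPart_one, h, sub_self])
  refine ⟨hτ, ?_⟩
  rw [sub_eq_zero.1 h1]
  exact scottContinuous_normalPart hz₀ hτ.1

theorem scottContinuous_smul {τ : M.Elem →L[ℂ] M.Elem} (hτ : IsCP τ) (hn : ScottContinuous τ)
    {r : ℝ} (hr : 0 ≤ r) : ScottContinuous ((r : ℂ) • τ) := by
  intro D hne hD y hy
  have : Nonempty D := hne.to_subtype
  have : IsDirectedOrder D := directedOn_iff_isDirectedOrder.1 hD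
  refine ⟨?_, fun c hc => le_iff.2 fun ξ => ?_⟩
  · rintro _ ⟨d, hd, rfl⟩
    exact (hτ.smul hr).monotone (hy.1 hd)
  · have h := (tendsto_comp_of_scottContinuous hn hne hD hy
      (vectorFunctional_mem_predual ξ ξ)).const_smul (r : ℂ)
    have h' : Tendsto (fun d : D => vectorFunctional ξ ξ (((r : ℂ) • τ) (d : M.Elem))) atTop
        (𝓝 (vectorFunctional ξ ξ (((r : ℂ) • τ) y))) := by
      simpa only [smul_apply, map_smul] using h
    exact le_of_tendsto h' (Eventually.of_forall fun d => le_iff.1 (hc ⟨d, d.2, rfl⟩) ξ)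

theorem exists_convex_combination_iff {z₀ : Bidual M.Elem} (hz₀ : IsNormalProjection z₀)
    {τ : M.Elem →L[ℂ] M.Elem} (hτ : τ ∈ CP M) {l : ℝ} (hl0 : 0 < l) (hl1 : l < 1) :
    (∃ τσ ∈ CPσ M, ∃ τs ∈ CPs z₀, τ = (l : ℂ) • τσ + (1 - l : ℂ) • τs) ↔
      normalExt τ z₀ = (l : ℂ) • (1 : M.Elem) := by
  have hl : (l : ℂ) ≠ 0 := by exact_mod_cast hl0.ne'
  have hl' : (1 - l : ℂ) ≠ 0 := by
    have : (1 - l : ℝ) ≠ 0 := (sub_pos.2 hl1).ne'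
    exact_mod_cast this
  constructor
  · rintro ⟨τσ, hσ, τs, hs, rfl⟩
    rw [normalExt_add, normalExt_smul, normalExt_smul, add_apply, smul_apply, smul_apply,
      normalExt_eq_one_of_scottContinuous hz₀ hσ.1 hσ.2, (mem_CPs_iff hz₀ hs.1).1 hs, smul_zero,
      add_zero]
  · intro h
    have hσcp : ((l⁻¹ : ℝ) : ℂ) • normalPart τ z₀ ∈ CP M :=
      ⟨(isCP_normalPart hz₀ hτ.1).smul (inv_nonneg.2 hl0.le), by
        rw [smul_apply, normalPart_one, h, smul_smul, Complex.ofReal_inv, inv_mul_cancel₀ hl,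
          one_smul]⟩
    have hσ : ((l⁻¹ : ℝ) : ℂ) • normalPart τ z₀ ∈ CPσ M := ⟨hσcp,
      scottContinuous_smul (isCP_normalPart hz₀ hτ.1) (scottContinuous_normalPart hz₀ hτ.1)
        (inv_nonneg.2 hl0.le)⟩
    have hscp : (((1 - l)⁻¹ : ℝ) : ℂ) • (τ - normalPart τ z₀) ∈ CP M :=
      ⟨(isCP_sub_normalPart hz₀ hτ.1).smul (inv_nonneg.2 (sub_pos.2 hl1).le), by
        have h1 : (1 : M.Elem) - (l : ℂ) • 1 = (1 - l : ℂ) • 1 := by module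
        rw [smul_apply, sub_apply, hτ.2, normalPart_one, h, h1, smul_smul, Complex.ofReal_inv,
          Complex.ofReal_sub, Complex.ofReal_one, inv_mul_cancel₀ hl', one_smul]⟩
    have hdec : τ = (l : ℂ) • (((l⁻¹ : ℝ) : ℂ) • normalPart τ z₀) +
        (1 - l : ℂ) • ((((1 - l)⁻¹ : ℝ) : ℂ) • (τ - normalPart τ z₀)) := by
      rw [smul_smul, smul_smul, Complex.ofReal_inv, Complex.ofReal_inv, Complex.ofReal_sub,
        Complex.ofReal_one, mul_inv_cancel₀ hl, mul_inv_cancel₀ hl', one_smul, one_smul,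
        add_sub_cancel]
    refine ⟨_, hσ, _, (mem_CPs_iff hz₀ hscp).2 ?_, hdec⟩
    -- Evaluating the decomposition at `z₀` gives `λ1 = λ1 + (1-λ)τ̃_s(z₀)`, so the second piece is
    -- singular.
    have h1 := congrArg (fun κ => normalExt κ z₀) hdec
    simp only [normalExt_add] at h1
    rw [normalExt_smul, normalExt_smul (1 - l : ℂ), add_apply, smul_apply, smul_apply,
      normalExt_eq_one_of_scottContinuous hz₀ hσcp hσ.2, h, left_eq_add] at h1
    exact (smul_eq_zero_iff_right hl').1 h1

/-- `τ̃(z₀)` and `1 - τ̃(z₀)` are the values at `1` of two completely positive maps. The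
nonvanishing hypothesis supplies a nonzero vector, without which `c` would be arbitrary. -/
theorem scalar_mem_unitInterval {z₀ : Bidual M.Elem} (hz₀ : IsNormalProjection z₀)
    {τ : M.Elem →L[ℂ] M.Elem} (hτ : τ ∈ CP M) {c : ℂ} (hc : normalExt τ z₀ = c • (1 : M.Elem))
    (h0 : normalExt τ z₀ ≠ 0) : c = (c.re : ℂ) ∧ 0 ≤ c.re ∧ c.re ≤ 1 := by
  obtain ⟨ξ, hξ⟩ : ∃ ξ : H, ξ ≠ 0 := by
    by_contra! hall
    exact h0 (elem_ext fun ξ η => by rw [hall ξ]; simp)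
  have hpos : (0 : ℝ) < ‖ξ‖ ^ 2 := by positivity
  have hinner : ⟪ξ, (normalExt τ z₀ : H →L[ℂ] H) ξ⟫_ℂ = ((‖ξ‖ ^ 2 : ℝ) : ℂ) * c := by
    rw [hc]
    change ⟪ξ, c • ξ⟫_ℂ = _
    rw [inner_smul_right, inner_self_eq_norm_sq_to_K, mul_comm]
    simp
  have hn0 : 0 ≤ normalExt τ z₀ := by
    rw [← normalPart_one]
    exact (isCP_normalPart hz₀ hτ.1).nonneg elem_zero_le_one
  have hn1 : normalExt τ z₀ ≤ 1 := by
    have h := (isCP_sub_normalPart hz₀ hτ.1).nonneg elem_zero_le_one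
    rw [sub_apply, hτ.2, normalPart_one] at h
    exact elem_sub_nonneg.1 h
  have i0 := Complex.nonneg_iff.1 (nonneg_iff.1 hn0 ξ)
  have i1 := re_inner_mono hn1 ξ
  have hone : (⟪ξ, ((1 : M.Elem) : H →L[ℂ] H) ξ⟫_ℂ).re = ‖ξ‖ ^ 2 := inner_one_re ξ
  rw [hinner, Complex.re_ofReal_mul, Complex.im_ofReal_mul] at i0
  rw [hinner, Complex.re_ofReal_mul, hone] at i1
  have him : c.im = 0 := by
    rcases mul_eq_zero.1 i0.2.symm with h | h
    · exact absurd h hpos.ne'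
    · exact h
  exact ⟨Complex.ext rfl (by simp [him]), nonneg_of_mul_nonneg_right i0.1 hpos,
    le_of_mul_le_mul_left (by rwa [mul_one]) hpos⟩

end VonNeumannAlgebra

end

/-! ### The proposition -/

open VonNeumannAlgebra in
theorem proposition2p6 {H : Type*} [NormedAddCommGroup H] [InnerProductSpace ℂ H]
    [CompleteSpace H] (M : VonNeumannAlgebra H) (z₀ : Bidual M.Elem)
    (hz₀ : IsNormalProjection z₀) :
    -- `τ̃` is the unique unital normal completely positive map with the duality relation
    (∀ τ ∈ CP M, IsNormalExt τ (normalExt τ) ∧ ∀ T, IsNormalExt τ T → T = normalExt τ) ∧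
    -- proper convex combinations with a given weight
    (∀ τ ∈ CP M, ∀ l : ℝ, 0 < l → l < 1 →
      ((∃ τσ ∈ CPσ M, ∃ τs ∈ CPs z₀, τ = (l : ℂ) • τσ + (1 - l : ℂ) • τs) ↔
        normalExt τ z₀ = (l : ℂ) • (1 : M.Elem))) ∧
    -- all the cases in which `τ̃(z₀)` is a scalar
    (∀ τ ∈ CP M,
      ((∃ c : ℂ, normalExt τ z₀ = c • (1 : M.Elem)) ↔
        (τ ∈ CPσ M ∨ τ ∈ CPs z₀ ∨ ∃ l : ℝ, 0 < l ∧ l < 1 ∧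
          ∃ τσ ∈ CPσ M, ∃ τs ∈ CPs z₀, τ = (l : ℂ) • τσ + (1 - l : ℂ) • τs))) ∧
    -- the map `τ ↦ τ̃` on `CP` is affine and one-to-one
    (∀ τ₁ ∈ CP M, ∀ τ₂ ∈ CP M, ∀ t : ℝ, 0 ≤ t → t ≤ 1 →
      normalExt ((t : ℂ) • τ₁ + (1 - t : ℂ) • τ₂) =
        (t : ℂ) • normalExt τ₁ + (1 - t : ℂ) • normalExt τ₂) ∧
    Set.InjOn normalExt (CP M) := by
  refine ⟨fun τ hτ => ⟨isNormalExt_normalExt hτ, fun T hT => hT.eq_normalExt⟩,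
    fun τ hτ l hl0 hl1 => exists_convex_combination_iff hz₀ hτ hl0 hl1, fun τ hτ => ⟨?_, ?_⟩,
    fun τ₁ _ τ₂ _ t _ _ => ?_, fun τ₁ _ τ₂ _ h => ?_⟩
  · rintro ⟨c, hc⟩
    -- Treating the zero operator first also covers `H = 0`, where the scalar is not determined.
    by_cases h0 : normalExt τ z₀ = 0
    · exact .inr (.inl ((mem_CPs_iff hz₀ hτ).2 h0))
    by_cases h1 : normalExt τ z₀ = 1
    · exact .inl (mem_CPσ_of_normalExt_eq_one hz₀ hτ h1)
    right; right
    obtain ⟨hcr, hr0, hr1⟩ := scalar_mem_unitInterval hz₀ hτ hc h0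
    have hne0 : c.re ≠ 0 := fun h => h0 (by rw [hc, hcr, h]; simp)
    have hne1 : c.re ≠ 1 := fun h => h1 (by rw [hc, hcr, h]; simp)
    have hl0 := lt_of_le_of_ne hr0 hne0.symm
    have hl1 := lt_of_le_of_ne hr1 hne1
    exact ⟨c.re, hl0, hl1, (exists_convex_combination_iff hz₀ hτ hl0 hl1).2 (by rw [hc, ← hcr])⟩
  · rintro (h | h | ⟨l, hl0, hl1, h⟩)
    · exact ⟨1, by rw [normalExt_eq_one_of_scottContinuous hz₀ hτ h.2, one_smul]⟩
    · exact ⟨0, by rw [(mem_CPs_iff hz₀ hτ).1 h, zero_smul]⟩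
    · exact ⟨l, (exists_convex_combination_iff hz₀ hτ hl0 hl1).1 h⟩
  · rw [normalExt_add, normalExt_smul, normalExt_smul]
  · ext1 a
    rw [← normalExt_incl, h, normalExt_incl]
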